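/- Let $d\ge 1$ and $L\ge 2$ be integers, and let $\mathbb H=\bigoplus_{i\ge 1}(\mathbb Z/L\mathbb Z)^d$ be the hierarchical lattice. Put $\|0\|=0$, and for $x=(x_1,x_2,\dots)\in\mathbb H\setminus\{0\}$ put $\|x\|=L^i$, where $i$ is the largest index with $x_i\ne 0$. For $n\ge1$ let $\Lambda_n=\{x\in\mathbb H:\|x\|\le L^n\}$, so that $|\Lambda_n|=L^{nd}$. Let $0<\alpha<d$ and $0<A_1\le A_2$, and let $\rho:[0,\infty)\to[0,\infty)$ satisfy $\rho(0)=0$ and $A_1r^{-\alpha}\le\rho(r)\le A_2r^{-\alpha}$ for all $r\ge 1$. Put $J(x,y)=\rho(\|x-y\|)$ for $x,y\in\mathbb H$. For a symmetric $\kappa:\mathbb H\times\mathbb H\to[0,\infty)$ let $G(\kappa)$ be the random graph on $\mathbb H$ in which each pair $x\ne y$ is joined by an edge, independently, with probability $1-e^{-\kappa(x,y)}$. Let $\mathcal C_1^{(n)}(\kappa)$ be the largest connected component of the subgraph of $G(\kappa)$ induced on $\Lambda_n$, and $|\mathcal C_1^{(n)}(\kappa)|$ its number of vertices. **Normalization.**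 For every $n\ge1$ with $L^{nd}>2$ there is a unique $\zeta_n>0$ such that $$(L^d-1)\sum_{i=1}^n L^{(i-1)d}\exp\big(-\zeta_n^{-1}\rho(L^i)\big)=L^{nd}-2,$$ and there are constants $C,C'>0$ depending only on $A_1,A_2,L,d,\alpha$ such that $C L^{n(d-\alpha)}\le\zeta_n\le C'L^{n(d-\alpha)}$ for all such $n$. For $t>-1$ put $r_t^{(n)}(x,y)=(1+t)\,\zeta_n^{-1}J(x,y)$. Then a phase transition occurs at $\beta=\zeta_n^{-1}$ in the graphs $G(\beta J)$ restricted to $\Lambda_n$, in the following sense. **(a)** There is a constant $C>0$ depending only on $d$ and $L$ such that for every $\varepsilon\in(0,1)$, $$\mathbb P\big(|\mathcal C_1^{(n)}(r_{-\varepsilon}^{(n)})|\le C\,n\,\varepsilon^{-2}\big)\to 1\quad\text{as } n\to\infty.$$ **(b)** For every $\varepsilon>0$ there is a constant $C>0$ depending only on $\varepsilon,\alpha,A_1,A_2,d,L$ such that $$\mathbb P\big(|\mathcal C_1^{(n)}(r_{\varepsilon}^{(n)})|\ge C\,L^{nd}\big)\to 1\quad\text{as } n\to\infty.$$ -/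

import Mathlib

open Filter Topology MeasureTheory ProbabilityTheory

noncomputable section

namespace HLPercolation

/-! ### Independent-edge random graphs -/

/-- The edge probability `1 - exp (-u)` as a point of `[0, 1]`. For `u ≥ 0` (the only values of a
kernel that occur) the projection does nothing. -/
def edgeProb (u : ℝ) : unitInterval :=
  Set.projIcc 0 1 zero_le_one (1 - Real.exp (-u))

/-- The joint law of the edge indicators: independently over the unordered pairs `s(x, y)`, the
indicator is `true` with probability `1 - exp (-κ x y)`. -/
def edgeLaw {V : Type*} (κ : V → V → ℝ) (hκ : ∀ x y, κ x y = κ y x) :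
    Measure (Sym2 V → Bool) :=
  Measure.infinitePi fun e : Sym2 V =>
    bernoulliMeasure true false (edgeProb (Sym2.lift ⟨κ, hκ⟩ e))

/-- The simple graph with the edge indicators `ω` (the indicators of loops are ignored). -/
def graphOf {V : Type*} (ω : Sym2 V → Bool) : SimpleGraph V where
  Adj x y := x ≠ y ∧ ω s(x, y) = true
  symm := ⟨fun x y h => ⟨h.1.symm, by rw [Sym2.eq_swap]; exact h.2⟩⟩
  loopless := ⟨fun _ h => h.1 rfl⟩

/-- The number of vertices of the largest connected component of a graph (on a finite vertex
type; the supremum is then a maximum). -/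
def largestComponentCard {V : Type*} (G : SimpleGraph V) : ℕ :=
  ⨆ c : G.ConnectedComponent, c.supp.ncard

/-! ### The hierarchical lattice -/

/-- The `d`-dimensional discrete torus with `L ^ d` points. -/
abbrev Torus (L d : ℕ) : Type := Fin d → ZMod L

/-- The hierarchical lattice: the direct sum of countably many copies of the torus.
The coordinates are numbered from `0`, so that coordinate `j` here is coordinate `j + 1` in the
numbering `1, 2, 3, …`. -/
abbrev Lattice (L d : ℕ) : Type := ℕ →₀ Torus L d

/-- `‖0‖ = 0`, and `‖x‖ = L ^ i` if, in the numbering `1, 2, 3, …`, the last nonzero coordinate of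
`x` has number `i`. -/
def hnorm {L d : ℕ} (x : Lattice L d) : ℕ :=
  open Classical in if x = 0 then 0 else L ^ (x.support.sup fun j => j + 1)

/-- The closed ball `B(x, r)`. -/
def hball {L d : ℕ} (x : Lattice L d) (r : ℝ) : Set (Lattice L d) :=
  {y | (hnorm (y - x) : ℝ) ≤ r}

/-- `Λ_n = B(0, L ^ n)`. -/
def box (L d n : ℕ) : Set (Lattice L d) := hball 0 ((L : ℝ) ^ n)

theorem hnorm_sub_comm {L d : ℕ} (x y : Lattice L d) : hnorm (x - y) = hnorm (y - x) := by
  have h : (x - y).support = (y - x).support := by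
    rw [← Finsupp.support_neg, neg_sub]
  simp only [hnorm, h, sub_eq_zero, eq_comm]

/-! ### The kernel, the critical normalization, and the graph at `(1 + t) * ζ⁻¹ * J` -/

/-- `ρ : [0, ∞) → [0, ∞)` with `ρ 0 = 0` and `A₁ r ^ (-α) ≤ ρ r ≤ A₂ r ^ (-α)` for `r ≥ 1`. -/
structure IsProfile (α A₁ A₂ : ℝ) (ρ : ℝ → ℝ) : Prop where
  nonneg : ∀ r, 0 ≤ r → 0 ≤ ρ r
  zero : ρ 0 = 0
  lower : ∀ r, 1 ≤ r → A₁ * r ^ (-α) ≤ ρ r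
  upper : ∀ r, 1 ≤ r → ρ r ≤ A₂ * r ^ (-α)

/-- `J(x, y) = ρ(‖x - y‖)`. -/
def kernelJ {L d : ℕ} (ρ : ℝ → ℝ) (x y : Lattice L d) : ℝ := ρ (hnorm (x - y))

/-- `z` is a positive solution of
`(L ^ d - 1) * ∑_{i = 1}^n L ^ ((i - 1) d) * exp (- z⁻¹ * ρ (L ^ i)) = L ^ (n d) - 2`. -/
def IsCritical (L d : ℕ) (ρ : ℝ → ℝ) (n : ℕ) (z : ℝ) : Prop :=
  0 < z ∧
    ((L : ℝ) ^ d - 1) * ∑ i ∈ Finset.Icc 1 n,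
        (L : ℝ) ^ ((i - 1) * d) * Real.exp (-(z⁻¹ * ρ ((L : ℝ) ^ i)))
      = (L : ℝ) ^ (n * d) - 2

/-- The number `ζ_n`: the positive solution of the above equation (and `1` if there is none, which
happens only if `L ^ (n * d) ≤ 2`). -/
def zeta (L d : ℕ) (ρ : ℝ → ℝ) (n : ℕ) : ℝ :=
  open Classical in if h : ∃ z, IsCritical L d ρ n z then h.choose else 1

/-- The kernel `r_t(x, y) = (1 + t) * ζ_n⁻¹ * J(x, y)`. -/
def kernelR {L d : ℕ} (ρ : ℝ → ℝ) (n : ℕ) (t : ℝ) (x y : Lattice L d) : ℝ :=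
  (1 + t) * (zeta L d ρ n)⁻¹ * kernelJ ρ x y

theorem kernelR_symm {L d : ℕ} (ρ : ℝ → ℝ) (n : ℕ) (t : ℝ) (x y : Lattice L d) :
    kernelR ρ n t x y = kernelR ρ n t y x := by
  simp only [kernelR, kernelJ, hnorm_sub_comm x y]

/-- The law of the edge indicators of the random graph on the whole lattice with kernel `r_t`. -/
def lawR (L d : ℕ) (ρ : ℝ → ℝ) (n : ℕ) (t : ℝ) : Measure (Sym2 (Lattice L d) → Bool) :=
  edgeLaw (kernelR ρ n t) (kernelR_symm ρ n t)

/-- The size of the largest component of the subgraph induced on `Λ_n`. -/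
def maxComponent {L d : ℕ} (n : ℕ) (ω : Sym2 (Lattice L d) → Bool) : ℕ :=
  largestComponentCard ((graphOf ω).induce (box L d n))

end HLPercolation

end

open HLPercolation

/-!
The box `Λ_n` is finite and homogeneous, and the number `ζ_n` is defined in such a way that the mean
degree `D_n(β)` of a vertex of `G(β J)` in `Λ_n` equals `1` at `β = ζ_n⁻¹` (`isCritical_iff`). As `D_n`
is strictly increasing and continuous, `ζ_n` exists and is unique, and its order of magnitude comes from
the fact that the degree is carried by the top levels of the hierarchy (`IsCritical.le`,
`IsCritical.ge`). In particular `ζ_n⁻¹ → 0`, single edges have vanishing probability, and `D_n` is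
asymptotically linear near `ζ_n⁻¹`: the graph at `(1 + t) ζ_n⁻¹ J` has mean degree `1 + t + o(1)`.

Both regimes rest on one estimate, `lintegral_clusterWeight_le`. Explore the cluster `C_S(A)` of a set
`A` in a vertex set `S` by processing a vertex `x` of `A`: `x` is removed, and its neighbours in `S \ A`
are added to `A` (`card_cluster`). These neighbours are independent of the graph on `S \ {x}`, hence
induction on `S` gives `E[z ^ |C_S(A)|; |C_S(A)| ≤ k] ≤ M ^ |A|` as soon as
`z * exp ((M - 1) * Σ_{y ∈ S \ D} p x y) ≤ M` for all `x` and all sets `D` of at most `k` vertices.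

* If the mean degrees are at most `1 - δ`, take `M = 1 + δ`, `z = exp (δ ^ 2 / 2)`, and no restriction
  by `k`: cluster sizes have exponential tails of rate `δ ^ 2 / 2`, and a union bound over the vertices
  bounds the largest component (`measure_lt_largestComponentCard_le`).
* If the mean degrees remain at least `1 + δ` after the removal of any `θ |S|` vertices, take
  `M = 1 - δ / 4 < 1` and `z = exp (δ ^ 2 / 8) > 1`: for any `A`, the cluster of `A` has a size in
  `[θ |S| / 2, θ |S|]` with exponentially small probability. If all components had size less than
  `θ |S| / 2`, then the union of the components of the first `j` vertices would, as `j` grows, have to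
  hit this window. A union bound over `j` excludes this (`measure_largestComponentCard_lt_le`), with no
  need of a sprinkling argument. The hypothesis on `θ` is verified in `exists_proportion`.
-/

namespace HLPercolation

open scoped ENNReal

/-! ### Clusters inside a finite vertex set -/

section Cluster

variable {V : Type*}

open scoped Classical in
/-- The set of vertices of `S` that can be reached from `A` by paths of `G` inside `S`, described as
the smallest set that contains `A` and is closed under adjacency inside `S`. -/
noncomputable def cluster (G : SimpleGraph V) (S A : Finset V) : Finset V :=
  S.filter fun y => ∀ T : Set V, ↑A ⊆ T → (∀ u ∈ S, u ∈ T → ∀ v ∈ S, G.Adj u v → v ∈ T) → y ∈ T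

variable {G : SimpleGraph V} {S A : Finset V}

theorem mem_cluster {y : V} : y ∈ cluster G S A ↔ y ∈ S ∧ ∀ T : Set V, ↑A ⊆ T →
    (∀ u ∈ S, u ∈ T → ∀ v ∈ S, G.Adj u v → v ∈ T) → y ∈ T := by
  simp only [cluster, Finset.mem_filter]

theorem cluster_subset : cluster G S A ⊆ S := fun _ hy => (mem_cluster.1 hy).1

theorem subset_cluster (hA : A ⊆ S) : A ⊆ cluster G S A := fun _ ha =>
  mem_cluster.2 ⟨hA ha, fun _ hT _ => hT ha⟩

theorem mem_cluster_of_adj {u v : V} (hu : u ∈ cluster G S A) (hv : v ∈ S) (h : G.Adj u v) :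
    v ∈ cluster G S A :=
  mem_cluster.2 ⟨hv, fun T hT hc =>
    hc u (cluster_subset hu) ((mem_cluster.1 hu).2 T hT hc) v hv h⟩

theorem cluster_subset_of_closed {T : Set V} (hT : ↑A ⊆ T)
    (hc : ∀ u ∈ S, u ∈ T → ∀ v ∈ S, G.Adj u v → v ∈ T) : ↑(cluster G S A) ⊆ T := fun _ hy =>
  (mem_cluster.1 hy).2 T hT hc

theorem cluster_empty : cluster G S ∅ = ∅ := by
  have := cluster_subset_of_closed (G := G) (S := S) (A := ∅) (T := ∅) (by simp) (by simp)
  simpa using this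

theorem cluster_self : cluster G S S = S :=
  Finset.Subset.antisymm cluster_subset (subset_cluster Finset.Subset.rfl)

theorem cluster_insert_subset [DecidableEq V] (v : V) (hA : A ⊆ S) (hv : v ∈ S) :
    cluster G S (insert v A) ⊆ cluster G S A ∪ cluster G S {v} := by
  rw [← Finset.coe_subset]
  refine cluster_subset_of_closed ?_ ?_
  · intro y hy
    rcases Finset.mem_insert.1 hy with rfl | hy
    · exact Finset.mem_union_right _ (subset_cluster (by simpa using hv) (by simp))
    · exact Finset.mem_union_left _ (subset_cluster hA hy)
  · intro u _ hu w hw h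
    rcases Finset.mem_union.1 hu with hu | hu
    · exact Finset.mem_union_left _ (mem_cluster_of_adj hu hw h)
    · exact Finset.mem_union_right _ (mem_cluster_of_adj hu hw h)

open scoped Classical in
/-- One exploration step: processing the vertex `x` of `A` removes it from the vertex set and adds
its neighbours in `S \ A` to the set of vertices still to be explored. -/
theorem cluster_eq_insert {x : V} (hA : A ⊆ S) (hx : x ∈ A) :
    cluster G S A = insert x
      (cluster G (S.erase x) (A.erase x ∪ (S \ A).filter fun y => G.Adj x y)) := by
  set B := (S \ A).filter fun y => G.Adj x y with hB
  have hsub : A.erase x ∪ B ⊆ S.erase x := by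
    intro y hy
    rcases Finset.mem_union.1 hy with hy | hy
    · exact Finset.erase_subset_erase _ hA hy
    · have h := Finset.mem_sdiff.1 (Finset.mem_filter.1 hy).1
      exact Finset.mem_erase.2 ⟨fun h' => h.2 (h' ▸ hx), h.1⟩
  have hxC : x ∈ cluster G S A := subset_cluster hA hx
  apply Finset.Subset.antisymm
  · rw [← Finset.coe_subset]
    refine cluster_subset_of_closed ?_ ?_
    · intro y hy
      by_cases h : y = x
      · simp [h]
      · exact Finset.mem_insert_of_mem
          (subset_cluster hsub (Finset.mem_union_left _ (Finset.mem_erase.2 ⟨h, hy⟩)))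
    · intro u hu hu' v hv huv
      by_cases hvx : v = x
      · simp [hvx]
      refine Finset.mem_insert_of_mem ?_
      rcases Finset.mem_insert.1 hu' with rfl | hu'
      · refine subset_cluster hsub ?_
        by_cases hvA : v ∈ A
        · exact Finset.mem_union_left _ (Finset.mem_erase.2 ⟨hvx, hvA⟩)
        · exact Finset.mem_union_right _
            (Finset.mem_filter.2 ⟨Finset.mem_sdiff.2 ⟨hv, hvA⟩, huv⟩)
      · exact mem_cluster_of_adj hu' (Finset.mem_erase.2 ⟨hvx, hv⟩) huv
  · refine Finset.insert_subset hxC ?_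
    rw [← Finset.coe_subset]
    refine cluster_subset_of_closed ?_ ?_
    · intro y hy
      rcases Finset.mem_union.1 hy with hy | hy
      · exact subset_cluster hA (Finset.mem_of_mem_erase hy)
      · have h := Finset.mem_filter.1 hy
        exact mem_cluster_of_adj hxC (Finset.mem_sdiff.1 h.1).1 h.2
    · intro u _ hu v hv huv
      exact mem_cluster_of_adj hu (Finset.mem_of_mem_erase hv) huv

open scoped Classical in
theorem card_cluster {x : V} (hA : A ⊆ S) (hx : x ∈ A) :
    (cluster G S A).card =
      (cluster G (S.erase x) (A.erase x ∪ (S \ A).filter fun y => G.Adj x y)).card + 1 := by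
  rw [cluster_eq_insert hA hx, Finset.card_insert_of_notMem]
  exact fun h => Finset.notMem_erase x S (cluster_subset h)

theorem cluster_congr {G' : SimpleGraph V} (h : ∀ u ∈ S, ∀ v ∈ S, G.Adj u v ↔ G'.Adj u v) :
    cluster G S A = cluster G' S A := by
  ext y
  simp only [mem_cluster]
  refine and_congr_right fun _ => forall_congr' fun T => forall_congr' fun _ => ?_
  refine imp_congr_left
    (forall₂_congr fun u hu => forall_congr' fun _ => forall₂_congr fun v hv => ?_)
  rw [h u hu v hv]

end Cluster

/-! ### Exponential moments of cluster sizes -/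

section Moment

theorem measurable_of_dependsOn {ι : Type*} {s : Finset ι} {β : Type*} [MeasurableSpace β]
    {f : (ι → Bool) → β} (hf : DependsOn f ↑s) : Measurable f := by
  have : Nonempty β := ⟨f fun _ => false⟩
  obtain ⟨g, rfl⟩ := dependsOn_iff_exists_comp.1 hf
  have : Measurable g := measurable_of_finite g
  exact this.comp (by fun_prop)

theorem lintegral_mul_of_dependsOn {ι : Type*} {μ : Measure (ι → Bool)}
    (hμ : iIndepFun (fun i (ω : ι → Bool) => ω i) μ) {s t : Finset ι} (hst : Disjoint s t)
    {f g : (ι → Bool) → ℝ≥0∞} (hf : DependsOn f ↑s) (hg : DependsOn g ↑t) :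
    ∫⁻ ω, f ω * g ω ∂μ = (∫⁻ ω, f ω ∂μ) * ∫⁻ ω, g ω ∂μ := by
  refine lintegral_mul_eq_lintegral_mul_lintegral_of_indepFun''
    (measurable_of_dependsOn hf).aemeasurable (measurable_of_dependsOn hg).aemeasurable ?_
  obtain ⟨f', rfl⟩ := dependsOn_iff_exists_comp.1 hf
  obtain ⟨g', rfl⟩ := dependsOn_iff_exists_comp.1 hg
  exact (hμ.indepFun_finset s t hst (fun i => measurable_pi_apply i)).comp
    (measurable_of_finite f') (measurable_of_finite g')

variable {V : Type*}

theorem dependsOn_cluster (S A : Finset V) :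
    DependsOn (fun ω : Sym2 V → Bool => cluster (graphOf ω) S A) ↑S.sym2 := by
  intro ω ω' h
  refine cluster_congr fun u hu v hv => ?_
  have := h s(u, v) (Finset.mem_coe.2 (Finset.mk_mem_sym2_iff.2 ⟨hu, hv⟩))
  simp [graphOf, this]

/-- The weight `z ^ |C|` of the cluster `C` of `A` in `S`, cut off at clusters of size `k`. -/
noncomputable def clusterWeight (z : ℝ≥0∞) (k : ℕ) (S A : Finset V) (ω : Sym2 V → Bool) : ℝ≥0∞ :=
  if (cluster (graphOf ω) S A).card ≤ k then z ^ (cluster (graphOf ω) S A).card else 0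

theorem dependsOn_clusterWeight (z : ℝ≥0∞) (k : ℕ) (S A : Finset V) :
    DependsOn (clusterWeight z k S A) ↑S.sym2 := by
  intro ω ω' h
  have := dependsOn_cluster S A h
  simp only at this
  simp only [clusterWeight, this]

theorem lintegral_prod_edge {μ : Measure (Sym2 V → Bool)}
    (hμ : iIndepFun (fun e (ω : Sym2 V → Bool) => ω e) μ) (x : V) (T : Finset V) (M : ℝ≥0∞) :
    ∫⁻ ω, ∏ y ∈ T, (if ω s(x, y) = true then M else 1) ∂μ =
      ∏ y ∈ T, ∫⁻ ω, (if ω s(x, y) = true then M else 1) ∂μ := by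
  have hinj : Function.Injective fun y : V => s(x, y) := fun y y' h => Sym2.congr_right.1 h
  have h := (hμ.precomp hinj).comp (fun _ (b : Bool) => if b = true then M else 1)
    (fun _ => measurable_of_finite _)
  refine lintegral_prod_eq_prod_lintegral_of_indepFun T _ h fun y => ?_
  exact (measurable_of_finite fun b : Bool => if b = true then M else 1).comp
    (measurable_pi_apply _)

open scoped Classical in
/-- The exponential moment of the cluster of `A` is at most `M ^ |A|` as soon as `M` dominates the
contribution of a single exploration step, whichever `k` vertices have been used up before. With
`M > 1` this bounds subcritical clusters from above; with `M < 1` and `z > 1` it says that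
supercritical clusters are unlikely to have a size of moderate order. -/
theorem lintegral_clusterWeight_le {μ : Measure (Sym2 V → Bool)}
    (hμ : iIndepFun (fun e (ω : Sym2 V → Bool) => ω e) μ) {M z : ℝ≥0∞} (S : Finset V) :
    ∀ (k : ℕ) (A : Finset V), A ⊆ S →
    (∀ x ∈ S, ∀ D ⊆ S, x ∈ D → D.card ≤ k →
      z * ∏ y ∈ S \ D, ∫⁻ ω, (if ω s(x, y) = true then M else 1) ∂μ ≤ M) →
    ∫⁻ ω, clusterWeight z k S A ω ∂μ ≤ M ^ A.card := by
  have : IsProbabilityMeasure μ := hμ.isProbabilityMeasure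
  induction S using Finset.strongInduction with
  | H S ih =>
  intro k A hA hM
  rcases A.eq_empty_or_nonempty with rfl | ⟨x, hx⟩
  · simp [clusterWeight, cluster_empty]
  by_cases hk : k < A.card
  · have : ∀ ω, clusterWeight z k S A ω = 0 := fun ω => by
      rw [clusterWeight, if_neg]
      exact not_le.2 (hk.trans_le (Finset.card_le_card (subset_cluster hA)))
    simp [this]
  push Not at hk
  have hxS := hA hx
  have hA0 : 0 < A.card := Finset.card_pos.2 ⟨x, hx⟩
  have hAe : (A.erase x).card + 1 = A.card := Finset.card_erase_add_one hx
  set N : (Sym2 V → Bool) → Finset V := fun ω => (S \ A).filter fun y => (graphOf ω).Adj x y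
  have hNdef : ∀ ω, N ω = (S \ A).filter fun y => ω s(x, y) = true := fun ω => by
    refine Finset.filter_congr fun y hy => ?_
    have : x ≠ y := fun h => (Finset.mem_sdiff.1 hy).2 (h ▸ hx)
    simp [graphOf, this]
  set E : Finset (Sym2 V) := (S \ A).image fun y => s(x, y)
  have hNdep : DependsOn N ↑E := by
    intro ω ω' h
    rw [hNdef, hNdef]
    refine Finset.filter_congr fun y hy => ?_
    rw [h s(x, y) (Finset.mem_coe.2 (Finset.mem_image_of_mem _ hy))]
  have hdisj : Disjoint E (S.erase x).sym2 := by
    rw [Finset.disjoint_left]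
    intro e he he'
    obtain ⟨y, _, rfl⟩ := Finset.mem_image.1 he
    exact Finset.notMem_erase x S (Finset.mk_mem_sym2_iff.1 he').1
  -- Decompose according to the set `B` of neighbours of `x` in `S \ A`.
  have hstep : ∀ ω, clusterWeight z k S A ω = ∑ B ∈ (S \ A).powerset,
      (if N ω = B then 1 else 0) * (z * clusterWeight z (k - 1) (S.erase x) (A.erase x ∪ B) ω) := by
    intro ω
    rw [Finset.sum_eq_single (N ω)]
    · have hc := card_cluster (G := graphOf ω) hA hx
      simp only [clusterWeight, hc, N, if_true, one_mul]
      by_cases h : (cluster (graphOf ω) (S.erase x)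
          (A.erase x ∪ (S \ A).filter fun y => (graphOf ω).Adj x y)).card + 1 ≤ k
      · rw [if_pos h, if_pos (by omega), pow_succ, mul_comm]
      · rw [if_neg h, if_neg (by omega), mul_zero]
    · intro B _ hB
      rw [if_neg (Ne.symm hB), zero_mul]
    · intro h
      exact absurd (Finset.mem_powerset.2 (Finset.filter_subset _ _)) h
  have hind : ∀ B, DependsOn (fun ω => if N ω = B then (1 : ℝ≥0∞) else 0) ↑E := fun B ω ω' h => by
    have := hNdep h
    simp only [this]
  have hIH : ∀ B ∈ (S \ A).powerset,
      ∫⁻ ω, clusterWeight z (k - 1) (S.erase x) (A.erase x ∪ B) ω ∂μ ≤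
        M ^ ((A.erase x).card + B.card) := by
    intro B hB
    have hBS := Finset.mem_powerset.1 hB
    have hd : Disjoint (A.erase x) B := by
      rw [Finset.disjoint_left]
      intro y hy hyB
      exact (Finset.mem_sdiff.1 (hBS hyB)).2 (Finset.mem_of_mem_erase hy)
    rw [← Finset.card_union_of_disjoint hd]
    refine ih _ (Finset.erase_ssubset hxS) (k - 1) _ ?_ ?_
    · intro y hy
      rcases Finset.mem_union.1 hy with hy | hy
      · exact Finset.erase_subset_erase _ hA hy
      · have h := Finset.mem_sdiff.1 (hBS hy)
        exact Finset.mem_erase.2 ⟨fun h' => h.2 (h' ▸ hx), h.1⟩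
    · intro w hw D hD hwD hDk
      have hxD : x ∉ D := fun h => Finset.notMem_erase x S (hD h)
      -- The explored vertex `x` joins the used-up vertices, which costs one unit of `k`.
      have := hM w (Finset.mem_of_mem_erase hw) (insert x D)
        (Finset.insert_subset hxS (hD.trans (Finset.erase_subset _ _)))
        (Finset.mem_insert_of_mem hwD) (by rw [Finset.card_insert_of_notMem hxD]; omega)
      rwa [Finset.sdiff_insert, ← Finset.erase_sdiff_comm] at this
  calc ∫⁻ ω, clusterWeight z k S A ω ∂μ
      = ∑ B ∈ (S \ A).powerset, ∫⁻ ω, (if N ω = B then 1 else 0) *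
          (z * clusterWeight z (k - 1) (S.erase x) (A.erase x ∪ B) ω) ∂μ := by
        simp_rw [hstep]
        refine lintegral_finsetSum _ fun B _ => ?_
        exact (measurable_of_dependsOn (hind B)).mul
          ((measurable_of_dependsOn (dependsOn_clusterWeight _ _ _ _)).const_mul z)
    _ ≤ ∑ B ∈ (S \ A).powerset, ∫⁻ ω, (if N ω = B then 1 else 0) *
          (z * M ^ ((A.erase x).card + B.card)) ∂μ := by
        refine Finset.sum_le_sum fun B hB => ?_
        rw [lintegral_mul_of_dependsOn hμ hdisj (hind B) (g := fun ω =>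
            z * clusterWeight z (k - 1) (S.erase x) (A.erase x ∪ B) ω)
            (fun ω ω' h => by
              simp only [dependsOn_clusterWeight z (k - 1) (S.erase x) (A.erase x ∪ B) h]),
          lintegral_const_mul _ (measurable_of_dependsOn (dependsOn_clusterWeight _ _ _ _)),
          lintegral_mul_const _ (measurable_of_dependsOn (hind B))]
        gcongr
        exact hIH B hB
    _ = ∫⁻ ω, z * M ^ (A.erase x).card * ∏ y ∈ S \ A, (if ω s(x, y) = true then M else 1) ∂μ := by
        rw [← lintegral_finsetSum _ fun B _ => (measurable_of_dependsOn (hind B)).mul_const _]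
        refine lintegral_congr fun ω => ?_
        rw [Finset.sum_eq_single (N ω) (fun B _ hB => by rw [if_neg (Ne.symm hB), zero_mul])
          (fun h => absurd (Finset.mem_powerset.2 (Finset.filter_subset _ _)) h), if_pos rfl, one_mul,
          Finset.prod_ite, Finset.prod_const, Finset.prod_const_one, mul_one, ← hNdef, pow_add,
          mul_assoc]
    _ = M ^ (A.erase x).card *
          (z * ∏ y ∈ S \ A, ∫⁻ ω, (if ω s(x, y) = true then M else 1) ∂μ) := by
        rw [lintegral_const_mul, lintegral_prod_edge hμ]
        · ring
        · refine Finset.measurable_prod _ fun y _ => ?_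
          exact (measurable_of_finite fun b : Bool => if b = true then M else 1).comp
            (measurable_pi_apply _)
    _ ≤ M ^ (A.erase x).card * M := by
        gcongr
        exact hM x hxS A hA hx hk
    _ = M ^ A.card := by rw [← pow_succ, hAe]

end Moment

/-! ### Clusters and the largest component -/

section Component

variable {V : Type*} {G : SimpleGraph V} {S : Finset V}

theorem largestComponentCard_induce_le {K : ℕ}
    (h : ∀ v ∈ S, (cluster G S {v}).card ≤ K) :
    largestComponentCard (G.induce (S : Set V)) ≤ K := by
  refine ciSup_le' fun c => ?_
  induction c using SimpleGraph.ConnectedComponent.ind with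
  | h v =>
  refine le_trans ?_ (h v v.2)
  rw [← Set.ncard_coe_finset, ← Set.ncard_image_of_injective _ Subtype.val_injective]
  refine Set.ncard_le_ncard ?_ (Finset.finite_toSet _)
  rintro _ ⟨w, hw, rfl⟩
  have hr : (G.induce (S : Set V)).Reachable v w :=
    (SimpleGraph.ConnectedComponent.exact hw).symm
  rw [SimpleGraph.reachable_iff_reflTransGen] at hr
  induction hr with
  | refl => exact subset_cluster (by simp) (by simp)
  | tail hab hbc ih =>
    rename_i b c
    have hb := ih ((SimpleGraph.ConnectedComponent.eq.2
      ((SimpleGraph.reachable_iff_reflTransGen _ _).2 hab)).symm)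
    exact mem_cluster_of_adj hb c.2 hbc

theorem card_cluster_le_largestComponentCard {v : V} (hv : v ∈ S) :
    (cluster G S {v}).card ≤ largestComponentCard (G.induce (S : Set V)) := by
  have hfin : Finite (G.induce (S : Set V)).ConnectedComponent := Quot.finite _
  refine le_trans ?_ (le_ciSup (Set.finite_range _).bddAbove
    ((G.induce (S : Set V)).connectedComponentMk ⟨v, hv⟩))
  rw [← Set.ncard_coe_finset, ← Set.ncard_image_of_injective _ Subtype.val_injective]
  refine Set.ncard_le_ncard ?_ (Set.toFinite _)
  refine cluster_subset_of_closed ?_ ?_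
  · simp only [Finset.coe_singleton, Set.singleton_subset_iff]
    exact ⟨⟨v, hv⟩, rfl, rfl⟩
  · rintro u _ ⟨⟨u', hu'⟩, hu, rfl⟩ w hw huw
    refine ⟨⟨w, hw⟩, ?_, rfl⟩
    have hadj : (G.induce (S : Set V)).Adj ⟨w, hw⟩ ⟨u', hu'⟩ := huw.symm
    rw [SimpleGraph.ConnectedComponent.mem_supp_iff] at hu ⊢
    rw [← hu]
    exact SimpleGraph.ConnectedComponent.eq.2 hadj.reachable

open scoped Classical in
/-- The first `j` vertices of `S`, in some fixed order. -/
noncomputable def initialVertices (S : Finset V) (j : ℕ) : Finset V := (S.toList.take j).toFinset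

theorem initialVertices_subset (j : ℕ) : initialVertices S j ⊆ S := fun v hv => by
  classical
  rw [initialVertices, List.mem_toFinset] at hv
  exact Finset.mem_toList.1 (List.mem_of_mem_take hv)

theorem initialVertices_card : initialVertices S S.card = S := by
  classical
  rw [initialVertices, ← Finset.length_toList, List.take_length, Finset.toList_toFinset]

/-- If all clusters are small, then the union of the components of the first `j` vertices grows in
small steps with `j`, so that it cannot jump over a window that is longer than these steps. -/
theorem exists_card_cluster_mem_window {a m : ℝ} (ha : 0 < a) (haS : a ≤ S.card)
    (hm : ∀ v ∈ S, ((cluster G S {v}).card : ℝ) ≤ m) :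
    ∃ j ≤ S.card, a ≤ (cluster G S (initialVertices S j)).card ∧
      ((cluster G S (initialVertices S j)).card : ℝ) ≤ a + m := by
  classical
  have hex : ∃ j, a ≤ (cluster G S (initialVertices S j)).card :=
    ⟨S.card, by rw [initialVertices_card, cluster_self]; exact haS⟩
  have hle : Nat.find hex ≤ S.card :=
    Nat.find_min' hex (by rw [initialVertices_card, cluster_self]; exact haS)
  refine ⟨Nat.find hex, hle, Nat.find_spec hex, ?_⟩
  have h0 : Nat.find hex ≠ 0 := fun h => by
    have := Nat.find_spec hex
    rw [h] at this
    simp [initialVertices, cluster_empty] at this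
    linarith
  obtain ⟨j, hj⟩ := Nat.exists_eq_succ_of_ne_zero h0
  have hjlt : j < S.toList.length := by rw [Finset.length_toList]; omega
  have hmin := Nat.find_min hex (m := j) (by omega)
  push Not at hmin
  have hv : S.toList[j] ∈ S := Finset.mem_toList.1 (List.getElem_mem hjlt)
  have hins : initialVertices S (j + 1) = insert S.toList[j] (initialVertices S j) := by
    rw [initialVertices, initialVertices, ← List.take_append_getElem hjlt, List.toFinset_append,
      Finset.union_comm]
    rfl
  rw [hj, Nat.succ_eq_add_one, hins]
  have h1 := (Finset.card_le_card (cluster_insert_subset (G := G) S.toList[j]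
    (initialVertices_subset j) hv)).trans (Finset.card_union_le _ _)
  have h2 : ((cluster G S (insert S.toList[j] (initialVertices S j))).card : ℝ) ≤
      (cluster G S (initialVertices S j)).card + (cluster G S {S.toList[j]}).card := by
    exact_mod_cast h1
  linarith [hm _ hv]

end Component

/-! ### Tail bounds for random graphs with independent edges -/

section Tail

variable {V : Type*} {κ : V → V → ℝ} (hκ : ∀ x y, κ x y = κ y x)

theorem iIndepFun_edgeLaw :
    iIndepFun (fun e (ω : Sym2 V → Bool) => ω e) (edgeLaw κ hκ) :=
  iIndepFun_infinitePi (X := fun _ b => b) fun _ => measurable_id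

theorem lintegral_edge_le (hnn : ∀ x y, 0 ≤ κ x y) {M : ℝ} (hM : 0 ≤ M) (x y : V) :
    ∫⁻ ω, (if ω s(x, y) = true then ENNReal.ofReal M else 1) ∂(edgeLaw κ hκ) ≤
      ENNReal.ofReal (Real.exp ((M - 1) * (1 - Real.exp (-κ x y)))) := by
  have h1 : ∫⁻ ω, (if ω s(x, y) = true then ENNReal.ofReal M else 1) ∂(edgeLaw κ hκ) =
      ∫⁻ b, (if b = true then ENNReal.ofReal M else 1)
        ∂((edgeLaw κ hκ).map fun ω => ω s(x, y)) := by
    rw [lintegral_map (measurable_of_finite _) (measurable_pi_apply _)]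
  have hp0 : 0 ≤ 1 - Real.exp (-κ x y) := by
    have := Real.exp_le_one_iff.2 (neg_nonpos.2 (hnn x y)); linarith
  have hp1 : 1 - Real.exp (-κ x y) ≤ 1 := by linarith [Real.exp_pos (-κ x y)]
  have hp : ((edgeProb (κ x y) : unitInterval) : ℝ) = 1 - Real.exp (-κ x y) := by
    rw [edgeProb, Set.projIcc_of_mem zero_le_one ⟨hp0, hp1⟩]
  rw [h1, edgeLaw, Measure.infinitePi_map_eval, bernoulliMeasure_def]
  rw [lintegral_add_measure, lintegral_smul_measure, lintegral_smul_measure, lintegral_dirac,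
    lintegral_dirac]
  have h2 : (unitInterval.toNNReal (edgeProb (κ x y)) : ℝ≥0∞) =
      ENNReal.ofReal (1 - Real.exp (-κ x y)) := by
    rw [← hp]; exact (ENNReal.ofReal_eq_coe_nnreal _).symm
  have h3 : (unitInterval.toNNReal (unitInterval.symm (edgeProb (κ x y))) : ℝ≥0∞) =
      ENNReal.ofReal (Real.exp (-κ x y)) := by
    rw [show Real.exp (-κ x y) = ((unitInterval.symm (edgeProb (κ x y)) : unitInterval) : ℝ) by
      rw [unitInterval.coe_symm_eq, hp]; ring]
    exact (ENNReal.ofReal_eq_coe_nnreal _).symm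
  simp only [Sym2.lift_mk, ENNReal.smul_def, smul_eq_mul, if_true, Bool.false_eq_true, if_false,
    mul_one]
  rw [h2, h3, ← ENNReal.ofReal_mul hp0, ← ENNReal.ofReal_add (by positivity) (Real.exp_pos _).le]
  refine ENNReal.ofReal_le_ofReal ?_
  have := Real.add_one_le_exp ((M - 1) * (1 - Real.exp (-κ x y)))
  linarith

/-- Markov's inequality for the exponential moment of a cluster. -/
theorem measure_card_cluster_le (hnn : ∀ x y, 0 ≤ κ x y) {S A : Finset V} (hA : A ⊆ S)
    {M c t : ℝ} (hM : 0 ≤ M) (hc : 0 ≤ c) (k : ℕ)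
    (hstep : open scoped Classical in ∀ x ∈ S, ∀ D ⊆ S, x ∈ D → D.card ≤ k →
      Real.exp c * Real.exp ((M - 1) * ∑ y ∈ S \ D, (1 - Real.exp (-κ x y))) ≤ M) :
    edgeLaw κ hκ {ω | t ≤ (cluster (graphOf ω) S A).card ∧ (cluster (graphOf ω) S A).card ≤ k} ≤
      ENNReal.ofReal (M ^ A.card * Real.exp (-(c * t))) := by
  classical
  have hE := lintegral_clusterWeight_le (iIndepFun_edgeLaw hκ) (M := ENNReal.ofReal M)
    (z := ENNReal.ofReal (Real.exp c)) S k A hA (by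
      intro x hx D hD hxD hDk
      refine le_trans ?_ (ENNReal.ofReal_le_ofReal (hstep x hx D hD hxD hDk))
      rw [Finset.mul_sum, Real.exp_sum, ENNReal.ofReal_mul (Real.exp_pos _).le,
        ENNReal.ofReal_prod_of_nonneg fun _ _ => (Real.exp_pos _).le]
      gcongr with y hy
      exact lintegral_edge_le hκ hnn hM x y)
  have hmarkov := mul_meas_ge_le_lintegral (μ := edgeLaw κ hκ)
    (measurable_of_dependsOn (dependsOn_clusterWeight (ENNReal.ofReal (Real.exp c)) k S A))
    (ENNReal.ofReal (Real.exp (c * t)))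
  have hsub : {ω | t ≤ (cluster (graphOf ω) S A).card ∧ (cluster (graphOf ω) S A).card ≤ k} ⊆
      {ω | ENNReal.ofReal (Real.exp (c * t)) ≤
        clusterWeight (ENNReal.ofReal (Real.exp c)) k S A ω} := by
    rintro ω ⟨h1, h2⟩
    simp only [Set.mem_ofPred_eq, clusterWeight, if_pos h2]
    rw [← ENNReal.ofReal_pow (Real.exp_pos _).le, ← Real.exp_nat_mul, mul_comm _ c]
    exact ENNReal.ofReal_le_ofReal (Real.exp_le_exp.2 (mul_le_mul_of_nonneg_left h1 hc))
  have h3 : ENNReal.ofReal (Real.exp (c * t)) * edgeLaw κ hκ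
      {ω | t ≤ (cluster (graphOf ω) S A).card ∧ (cluster (graphOf ω) S A).card ≤ k} ≤
      ENNReal.ofReal (M ^ A.card) := by
    rw [ENNReal.ofReal_pow hM]
    exact le_trans (mul_le_mul_right (measure_mono hsub) _) (hmarkov.trans hE)
  calc _ = ENNReal.ofReal (Real.exp (-(c * t))) * (ENNReal.ofReal (Real.exp (c * t)) *
        edgeLaw κ hκ {ω | t ≤ (cluster (graphOf ω) S A).card ∧
          (cluster (graphOf ω) S A).card ≤ k}) := by
        rw [← mul_assoc, ← ENNReal.ofReal_mul (Real.exp_pos _).le, ← Real.exp_add]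
        simp
    _ ≤ ENNReal.ofReal (Real.exp (-(c * t))) * ENNReal.ofReal (M ^ A.card) := by gcongr
    _ = _ := by rw [← ENNReal.ofReal_mul (Real.exp_pos _).le, mul_comm]

/-- In a random graph whose mean degrees are at most `1 - δ`, the cluster sizes have an
exponential tail of rate `δ ^ 2 / 2`. -/
theorem measure_lt_largestComponentCard_le (hnn : ∀ x y, 0 ≤ κ x y) {S : Finset V} {δ : ℝ}
    (hδ : 0 < δ) (hδ1 : δ ≤ 1)
    (hdeg : ∀ x ∈ S, ∑ y ∈ S, (1 - Real.exp (-κ x y)) ≤ 1 - δ) {t : ℝ} (ht : 0 ≤ t) :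
    edgeLaw κ hκ {ω | t < largestComponentCard ((graphOf ω).induce (S : Set V))} ≤
      ENNReal.ofReal (S.card * (2 * Real.exp (-(δ ^ 2 / 2 * t)))) := by
  classical
  have hp : ∀ x y, 0 ≤ 1 - Real.exp (-κ x y) := fun x y => by
    have := Real.exp_le_one_iff.2 (neg_nonpos.2 (hnn x y)); linarith
  have hsub : {ω | t < largestComponentCard ((graphOf ω).induce (S : Set V))} ⊆
      ⋃ v ∈ S, {ω | t ≤ (cluster (graphOf ω) S {v}).card ∧
        (cluster (graphOf ω) S {v}).card ≤ S.card} := by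
    intro ω hω
    by_contra hcon
    simp only [Set.mem_iUnion, Set.mem_ofPred_eq, not_exists, not_and] at hcon
    have h : largestComponentCard ((graphOf ω).induce (S : Set V)) ≤ ⌊t⌋₊ := by
      refine largestComponentCard_induce_le fun v hv => Nat.le_floor ?_
      by_contra h'
      exact hcon v hv (not_le.1 h').le (Finset.card_le_card cluster_subset)
    have h' : (t : ℝ) < largestComponentCard ((graphOf ω).induce (S : Set V)) := hω
    have := Nat.floor_le ht
    have h2 : (largestComponentCard ((graphOf ω).induce (S : Set V)) : ℝ) ≤ ⌊t⌋₊ := by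
      exact_mod_cast h
    linarith
  have hlog : Real.exp (δ ^ 2 / 2) * Real.exp (δ * (1 - δ)) ≤ 1 + δ := by
    rw [← Real.exp_add, ← Real.le_log_iff_exp_le (by linarith)]
    refine le_trans ?_ (Real.le_log_one_add_of_nonneg hδ.le)
    rw [le_div_iff₀ (by linarith)]
    nlinarith [pow_pos hδ 3]
  refine (measure_mono hsub).trans ((measure_biUnion_finset_le _ _).trans ?_)
  have hone : ∀ v ∈ S, edgeLaw κ hκ {ω | t ≤ (cluster (graphOf ω) S {v}).card ∧
      (cluster (graphOf ω) S {v}).card ≤ S.card} ≤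
        ENNReal.ofReal (2 * Real.exp (-(δ ^ 2 / 2 * t))) := by
    intro v hv
    refine (measure_card_cluster_le hκ hnn (Finset.singleton_subset_iff.2 hv) (M := 1 + δ)
      (c := δ ^ 2 / 2) (t := t) (by linarith) (by positivity) S.card ?_).trans ?_
    · intro x hx D _ _ _
      refine le_trans ?_ hlog
      have : ∑ y ∈ S \ D, (1 - Real.exp (-κ x y)) ≤ 1 - δ :=
        (Finset.sum_le_sum_of_subset_of_nonneg Finset.sdiff_subset fun y _ _ => hp x y).trans
          (hdeg x hx)
      rw [add_sub_cancel_left]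
      gcongr
    · refine ENNReal.ofReal_le_ofReal ?_
      rw [Finset.card_singleton, pow_one]
      gcongr
      linarith
  refine (Finset.sum_le_sum hone).trans ?_
  rw [Finset.sum_const, nsmul_eq_mul, ENNReal.ofReal_mul (Nat.cast_nonneg _), ENNReal.ofReal_natCast]

open scoped Classical in
/-- If the mean degrees stay above `1 + δ` after the removal of any `θ |S|` vertices, then the
largest component has size at least `θ |S| / 2` up to an exponentially small probability. -/
theorem measure_largestComponentCard_lt_le (hnn : ∀ x y, 0 ≤ κ x y) {S : Finset V} {δ θ : ℝ}
    (hδ : 0 < δ) (hδ1 : δ ≤ 1) (hθ : 0 < θ) (hθ1 : θ ≤ 1) (hS : 0 < S.card)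
    (hdeg : ∀ x ∈ S, ∀ D ⊆ S, (D.card : ℝ) ≤ θ * S.card →
      1 + δ ≤ ∑ y ∈ S \ D, (1 - Real.exp (-κ x y))) :
    edgeLaw κ hκ {ω | (largestComponentCard ((graphOf ω).induce (S : Set V)) : ℝ) <
        θ / 2 * S.card} ≤
      ENNReal.ofReal ((S.card + 1) * Real.exp (-(δ ^ 2 / 8 * (θ / 2 * S.card)))) := by
  have hS' : (0 : ℝ) < S.card := by exact_mod_cast hS
  have hsub : {ω | (largestComponentCard ((graphOf ω).induce (S : Set V)) : ℝ) <
        θ / 2 * S.card} ⊆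
      ⋃ j ∈ Finset.range (S.card + 1),
        {ω | θ / 2 * S.card ≤ (cluster (graphOf ω) S (initialVertices S j)).card ∧
        (cluster (graphOf ω) S (initialVertices S j)).card ≤ ⌊θ * S.card⌋₊} := by
    intro ω hω
    have hω' : (largestComponentCard ((graphOf ω).induce (S : Set V)) : ℝ) < θ / 2 * S.card := hω
    obtain ⟨j, hj, h1, h2⟩ := exists_card_cluster_mem_window (G := graphOf ω) (S := S)
      (a := θ / 2 * S.card) (m := θ / 2 * S.card) (by positivity) (by nlinarith) fun v hv =>
        le_trans (by exact_mod_cast card_cluster_le_largestComponentCard hv) hω'.le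
    simp only [Set.mem_iUnion, Set.mem_ofPred_eq]
    exact ⟨j, by simpa [Nat.lt_succ_iff] using hj, h1, Nat.le_floor (by linarith)⟩
  -- The parameter `1 - δ / 4` nearly maximizes the gain of a step.
  have hlog : Real.exp (δ ^ 2 / 8) * Real.exp (-(δ / 4) * (1 + δ)) ≤ 1 - δ / 4 := by
    rw [← Real.exp_add, ← Real.le_log_iff_exp_le (by linarith)]
    refine le_trans ?_ (Real.one_sub_inv_le_log_of_pos (by linarith))
    have h : (1 - δ / 4)⁻¹ ≤ 1 + δ / 4 + δ ^ 2 / 8 := by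
      rw [inv_le_iff_one_le_mul₀ (by linarith)]
      nlinarith [pow_pos hδ 2, pow_pos hδ 3]
    nlinarith
  refine (measure_mono hsub).trans ((measure_biUnion_finset_le _ _).trans ?_)
  have hone : ∀ j ∈ Finset.range (S.card + 1), edgeLaw κ hκ
      {ω | θ / 2 * S.card ≤ (cluster (graphOf ω) S (initialVertices S j)).card ∧
        (cluster (graphOf ω) S (initialVertices S j)).card ≤ ⌊θ * S.card⌋₊} ≤
        ENNReal.ofReal (Real.exp (-(δ ^ 2 / 8 * (θ / 2 * S.card)))) := by
    intro j _
    refine (measure_card_cluster_le hκ hnn (initialVertices_subset j) (M := 1 - δ / 4)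
      (c := δ ^ 2 / 8) (t := θ / 2 * S.card) (by linarith) (by positivity) _ ?_).trans ?_
    · intro x hx D hD _ hDk
      refine le_trans ?_ hlog
      have := hdeg x hx D hD ((Nat.cast_le.2 hDk).trans (Nat.floor_le (by positivity)))
      gcongr ?_ * Real.exp ?_
      nlinarith
    · refine ENNReal.ofReal_le_ofReal ?_
      exact mul_le_of_le_one_left (Real.exp_pos _).le (pow_le_one₀ (by linarith) (by linarith))
  refine (Finset.sum_le_sum hone).trans ?_
  rw [Finset.sum_const, nsmul_eq_mul, Finset.card_range, ENNReal.ofReal_mul (by positivity)]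
  gcongr
  rw [← Nat.cast_add_one, ENNReal.ofReal_natCast]

end Tail

/-! ### Sums over the boxes of the hierarchical lattice -/

section Box

variable {L d : ℕ}

/-- For `i ≥ 1`, the number `L ^ (i d) - L ^ ((i - 1) d)` of points at distance `L ^ i` from a given
point. -/
def sphereCard (L d i : ℕ) : ℝ := ((L : ℝ) ^ d - 1) * (L : ℝ) ^ ((i - 1) * d)

theorem sphereCard_succ (i : ℕ) :
    sphereCard L d (i + 1) = (L : ℝ) ^ ((i + 1) * d) - (L : ℝ) ^ (i * d) := by
  rw [sphereCard, Nat.add_sub_cancel, add_mul, one_mul, pow_add]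
  ring

theorem sum_sphereCard (n : ℕ) :
    ∑ i ∈ Finset.Icc 1 n, sphereCard L d i = (L : ℝ) ^ (n * d) - 1 := by
  induction n with
  | zero => simp
  | succ n ih => rw [Finset.sum_Icc_succ_top (by omega), ih, sphereCard_succ]; ring

/-- The box `Λ_n` as a finset: the elements of the lattice supported in the first `n`
coordinates. -/
noncomputable def boxFinset (L d n : ℕ) [NeZero L] : Finset (Lattice L d) :=
  (Finset.range n).finsupp fun _ => Finset.univ

variable [NeZero L]

theorem mem_boxFinset {n : ℕ} {x : Lattice L d} :
    x ∈ boxFinset L d n ↔ x.support ⊆ Finset.range n := by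
  simp [boxFinset, Finset.mem_finsupp_iff]

theorem hnorm_le_pow_iff (hL : 2 ≤ L) {n : ℕ} {x : Lattice L d} :
    hnorm x ≤ L ^ n ↔ x ∈ boxFinset L d n := by
  rw [mem_boxFinset, hnorm]
  split_ifs with h
  · simp [h]
  · rw [Nat.pow_le_pow_iff_right (by omega), Finset.sup_le_iff]
    exact forall₂_congr fun j _ => by rw [Finset.mem_range, Nat.succ_le_iff]

theorem box_eq_coe_boxFinset (hL : 2 ≤ L) (n : ℕ) :
    box L d n = (boxFinset L d n : Set (Lattice L d)) := by
  ext x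
  rw [Finset.mem_coe, ← hnorm_le_pow_iff hL]
  simp only [box, hball, sub_zero, Set.mem_ofPred_eq]
  norm_cast

theorem card_boxFinset (n : ℕ) : (boxFinset L d n).card = L ^ (n * d) := by
  rw [boxFinset, Finset.card_finsupp]
  simp [ZMod.card, ← pow_mul, mul_comm]

theorem boxFinset_mono {m n : ℕ} (h : m ≤ n) : boxFinset L d m ⊆ boxFinset L d n := fun x hx => by
  rw [mem_boxFinset] at hx ⊢
  exact hx.trans (Finset.range_subset_range.2 h)

theorem sub_mem_boxFinset {n : ℕ} {x y : Lattice L d} (hx : x ∈ boxFinset L d n)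
    (hy : y ∈ boxFinset L d n) : x - y ∈ boxFinset L d n := by
  rw [mem_boxFinset] at hx hy ⊢
  intro j hj
  rw [Finsupp.mem_support_iff, Finsupp.sub_apply] at hj
  by_cases h : x j = 0
  · refine hy (Finsupp.mem_support_iff.2 fun h' => hj ?_)
    rw [h, h', sub_zero]
  · exact hx (Finsupp.mem_support_iff.2 h)

theorem hnorm_eq_pow_succ (hL : 2 ≤ L) {n : ℕ} {x : Lattice L d}
    (hx : x ∈ boxFinset L d (n + 1)) (hx' : x ∉ boxFinset L d n) : hnorm x = L ^ (n + 1) := by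
  have h0 : x ≠ 0 := fun h => hx' (by rw [mem_boxFinset, h]; simp)
  rw [← hnorm_le_pow_iff hL] at hx hx'
  rw [hnorm, if_neg h0] at hx hx' ⊢
  rw [Nat.pow_le_pow_iff_right (by omega)] at hx hx'
  congr 1
  omega

theorem sum_boxFinset (hL : 2 ≤ L) (f : ℕ → ℝ) (n : ℕ) :
    ∑ y ∈ boxFinset L d n, f (hnorm y) =
      f 0 + ∑ i ∈ Finset.Icc 1 n, sphereCard L d i * f (L ^ i) := by
  classical
  induction n with
  | zero =>
    have : boxFinset L d 0 = {0} := by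
      ext x; simp [mem_boxFinset]
    rw [this]
    simp [hnorm]
  | succ n ih =>
    rw [Finset.sum_Icc_succ_top (by omega), ← add_assoc, ← ih,
      ← Finset.sum_sdiff (boxFinset_mono n.le_succ), add_comm]
    congr 1
    have h : ∀ y ∈ boxFinset L d (n + 1) \ boxFinset L d n, f (hnorm y) = f (L ^ (n + 1)) :=
      fun y hy => by
        rw [hnorm_eq_pow_succ hL (Finset.mem_sdiff.1 hy).1 (Finset.mem_sdiff.1 hy).2]
    rw [Finset.sum_congr rfl h, Finset.sum_const, nsmul_eq_mul,
      Finset.card_sdiff_of_subset (boxFinset_mono n.le_succ),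
      Nat.cast_sub (Finset.card_le_card (boxFinset_mono n.le_succ)), card_boxFinset,
      card_boxFinset, sphereCard_succ]
    push_cast
    rfl

theorem sum_boxFinset_sub (hL : 2 ≤ L) (f : ℕ → ℝ) {n : ℕ} {x : Lattice L d}
    (hx : x ∈ boxFinset L d n) :
    ∑ y ∈ boxFinset L d n, f (hnorm (x - y)) =
      f 0 + ∑ i ∈ Finset.Icc 1 n, sphereCard L d i * f (L ^ i) := by
  rw [← sum_boxFinset hL]
  exact Finset.sum_nbij' (fun y => x - y) (fun y => x - y) (fun y hy => sub_mem_boxFinset hx hy)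
    (fun y hy => sub_mem_boxFinset hx hy) (by simp) (by simp) (by simp)

end Box

/-! ### Mean degrees and the critical normalization -/

section Degree

variable {L d : ℕ} {α A₁ A₂ : ℝ} {ρ : ℝ → ℝ}

/-- The mean degree of a vertex of `Λ_n` in the graph `G(β J)` restricted to `Λ_n`. -/
noncomputable def meanDegree (L d : ℕ) (ρ : ℝ → ℝ) (n : ℕ) (β : ℝ) : ℝ :=
  ∑ i ∈ Finset.Icc 1 n, sphereCard L d i * (1 - Real.exp (-(β * ρ ((L : ℝ) ^ i))))

theorem isCritical_iff {n : ℕ} {z : ℝ} :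
    IsCritical L d ρ n z ↔ 0 < z ∧ meanDegree L d ρ n z⁻¹ = 1 := by
  have h1 : ((L : ℝ) ^ d - 1) * ∑ i ∈ Finset.Icc 1 n,
      (L : ℝ) ^ ((i - 1) * d) * Real.exp (-(z⁻¹ * ρ ((L : ℝ) ^ i))) =
      ∑ i ∈ Finset.Icc 1 n, sphereCard L d i * Real.exp (-(z⁻¹ * ρ ((L : ℝ) ^ i))) := by
    rw [Finset.mul_sum]
    exact Finset.sum_congr rfl fun i _ => by rw [sphereCard, mul_assoc]
  have h2 : meanDegree L d ρ n z⁻¹ = (L : ℝ) ^ (n * d) - 1 -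
      ∑ i ∈ Finset.Icc 1 n, sphereCard L d i * Real.exp (-(z⁻¹ * ρ ((L : ℝ) ^ i))) := by
    rw [← sum_sphereCard, ← Finset.sum_sub_distrib]
    exact Finset.sum_congr rfl fun i _ => by ring
  rw [IsCritical, h1, h2]
  refine and_congr_right fun _ => ⟨fun h => ?_, fun h => ?_⟩ <;> linarith

theorem two_le_pow (hd : 1 ≤ d) (hL : 2 ≤ L) : (2 : ℝ) ≤ (L : ℝ) ^ d := by
  have hL' : (2 : ℝ) ≤ L := by exact_mod_cast hL
  calc (2 : ℝ) ≤ L := hL'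
    _ = (L : ℝ) ^ 1 := (pow_one _).symm
    _ ≤ (L : ℝ) ^ d := pow_le_pow_right₀ (by linarith) hd

theorem sphereCard_pos (hd : 1 ≤ d) (hL : 2 ≤ L) (i : ℕ) : 0 < sphereCard L d i := by
  have := two_le_pow hd hL
  have hL' : (2 : ℝ) ≤ L := by exact_mod_cast hL
  exact mul_pos (by linarith) (by positivity)

/-- The factor `L ^ (d - α)` by which the mean number of neighbours grows from one level of the
lattice to the next. -/
noncomputable def growth (L d : ℕ) (α : ℝ) : ℝ := (L : ℝ) ^ ((d : ℝ) - α)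

theorem one_lt_growth (hL : 2 ≤ L) (hα : α < d) : 1 < growth L d α :=
  Real.one_lt_rpow (by exact_mod_cast hL) (by linarith)

theorem growth_pow (n : ℕ) : growth L d α ^ n = (L : ℝ) ^ ((n : ℝ) * ((d : ℝ) - α)) := by
  rw [growth, mul_comm, Real.rpow_mul_natCast (Nat.cast_nonneg _)]

theorem pow_mul_rpow_eq (hL : 2 ≤ L) (i : ℕ) :
    (L : ℝ) ^ (i * d) * ((L : ℝ) ^ i) ^ (-α) = growth L d α ^ i := by
  have hL0 : (0 : ℝ) < L := by exact_mod_cast (by omega : 0 < L)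
  rw [growth_pow, ← Real.rpow_natCast, ← Real.rpow_natCast, ← Real.rpow_mul hL0.le,
    ← Real.rpow_add hL0]
  congr 1
  push_cast
  ring

theorem one_le_pow_cast (hL : 2 ≤ L) (i : ℕ) : (1 : ℝ) ≤ (L : ℝ) ^ i :=
  one_le_pow₀ (by exact_mod_cast (by omega : 1 ≤ L))

theorem IsProfile.pos (h : IsProfile α A₁ A₂ ρ) (hA : 0 < A₁) {r : ℝ} (hr : 1 ≤ r) : 0 < ρ r :=
  lt_of_lt_of_le (by positivity) (h.lower r hr)

theorem IsProfile.le_const (h : IsProfile α A₁ A₂ ρ) (hα : 0 < α) (hA : 0 < A₂) {r : ℝ}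
    (hr : 1 ≤ r) : ρ r ≤ A₂ :=
  (h.upper r hr).trans
    (mul_le_of_le_one_right hA.le (Real.rpow_le_one_of_one_le_of_nonpos hr (by linarith)))

theorem sphereCard_mul_le (hL : 2 ≤ L) (h : IsProfile α A₁ A₂ ρ) {i : ℕ} (hi : 1 ≤ i) :
    sphereCard L d i * ρ ((L : ℝ) ^ i) ≤ A₂ * growth L d α ^ i := by
  obtain ⟨j, rfl⟩ := Nat.exists_eq_add_of_le' hi
  have hr := one_le_pow_cast hL (j + 1)
  have hρ := h.nonneg ((L : ℝ) ^ (j + 1)) (by linarith)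
  have h1 : sphereCard L d (j + 1) ≤ (L : ℝ) ^ ((j + 1) * d) := by
    rw [sphereCard_succ]
    linarith [one_le_pow_cast hL (j * d)]
  calc sphereCard L d (j + 1) * ρ ((L : ℝ) ^ (j + 1))
      ≤ (L : ℝ) ^ ((j + 1) * d) * (A₂ * ((L : ℝ) ^ (j + 1)) ^ (-α)) :=
        mul_le_mul h1 (h.upper _ hr) hρ (by positivity)
    _ = A₂ * growth L d α ^ (j + 1) := by rw [← pow_mul_rpow_eq hL]; ring

theorem sum_pow_le {r : ℝ} (hr : 1 < r) (m : ℕ) :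
    ∑ i ∈ Finset.Icc 1 m, r ^ i ≤ r / (r - 1) * r ^ m := by
  have h0 : 0 < r - 1 := by linarith
  induction m with
  | zero => simp; positivity
  | succ m ih =>
    rw [Finset.sum_Icc_succ_top (by omega)]
    have : r / (r - 1) * r ^ (m + 1) = r / (r - 1) * r ^ m + r ^ (m + 1) := by
      field_simp; ring
    linarith

/-- The sum of the kernel over a box is dominated by its top levels. -/
theorem sum_sphereCard_mul_le (hL : 2 ≤ L) (hα : α < d) (hA : 0 < A₂) (h : IsProfile α A₁ A₂ ρ)
    (m : ℕ) :
    ∑ i ∈ Finset.Icc 1 m, sphereCard L d i * ρ ((L : ℝ) ^ i) ≤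
      A₂ * (growth L d α / (growth L d α - 1)) * growth L d α ^ m := by
  calc _ ≤ ∑ i ∈ Finset.Icc 1 m, A₂ * growth L d α ^ i :=
        Finset.sum_le_sum fun i hi => sphereCard_mul_le hL h (Finset.mem_Icc.1 hi).1
    _ ≤ _ := by
        rw [← Finset.mul_sum, mul_assoc]
        exact mul_le_mul_of_nonneg_left (sum_pow_le (one_lt_growth hL hα) m) hA.le

theorem meanDegree_le (hd : 1 ≤ d) (hL : 2 ≤ L) (n : ℕ) (β : ℝ) :
    meanDegree L d ρ n β ≤ β * ∑ i ∈ Finset.Icc 1 n, sphereCard L d i * ρ ((L : ℝ) ^ i) := by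
  rw [meanDegree, Finset.mul_sum]
  refine Finset.sum_le_sum fun i _ => ?_
  have h1 := Real.add_one_le_exp (-(β * ρ ((L : ℝ) ^ i)))
  have h2 := (sphereCard_pos hd hL i).le
  calc _ ≤ sphereCard L d i * (β * ρ ((L : ℝ) ^ i)) := by gcongr; linarith
    _ = _ := by ring

theorem mul_one_sub_le_one_sub_exp_neg {u : ℝ} (hu : 0 ≤ u) : u * (1 - u) ≤ 1 - Real.exp (-u) := by
  have h1 := Real.add_one_le_exp u
  have h2 : Real.exp (-u) ≤ (u + 1)⁻¹ := by
    rw [Real.exp_neg]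
    exact inv_anti₀ (by linarith) h1
  have h3 : (u + 1)⁻¹ ≤ 1 - u + u ^ 2 := by
    rw [inv_le_iff_one_le_mul₀ (by linarith)]
    nlinarith [pow_nonneg hu 3]
  linarith

theorem le_meanDegree (hd : 1 ≤ d) (hL : 2 ≤ L) (hα : 0 < α) (hA₁ : 0 < A₁) (hA₂ : 0 < A₂)
    (h : IsProfile α A₁ A₂ ρ) (n : ℕ) {β : ℝ} (hβ : 0 ≤ β) :
    (1 - β * A₂) * (β * ∑ i ∈ Finset.Icc 1 n, sphereCard L d i * ρ ((L : ℝ) ^ i)) ≤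
      meanDegree L d ρ n β := by
  rw [meanDegree, Finset.mul_sum, Finset.mul_sum]
  refine Finset.sum_le_sum fun i _ => ?_
  have hr := one_le_pow_cast hL i
  have h0 := (h.pos hA₁ hr).le
  have h1 := mul_one_sub_le_one_sub_exp_neg (mul_nonneg hβ h0)
  have h2 := (sphereCard_pos hd hL i).le
  have h3 := mul_le_mul_of_nonneg_left (h.le_const hα hA₂ hr) hβ
  calc _ = sphereCard L d i * (β * ρ ((L : ℝ) ^ i) * (1 - β * A₂)) := by ring
    _ ≤ sphereCard L d i * (β * ρ ((L : ℝ) ^ i) * (1 - β * ρ ((L : ℝ) ^ i))) := by gcongr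
    _ ≤ _ := by gcongr

theorem one_le_of_two_lt_pow {n : ℕ} (hn : 2 < L ^ (n * d)) : 1 ≤ n := by
  rcases Nat.eq_zero_or_pos n with rfl | h
  · simp at hn
  · exact h

theorem meanDegree_strictMono (hd : 1 ≤ d) (hL : 2 ≤ L) (hA₁ : 0 < A₁)
    (h : IsProfile α A₁ A₂ ρ) {n : ℕ} (hn : 1 ≤ n) : StrictMono (meanDegree L d ρ n) := by
  intro β β' hβ
  refine Finset.sum_lt_sum_of_nonempty ⟨1, by simp [hn]⟩ fun i _ => ?_
  have h0 := h.pos hA₁ (one_le_pow_cast hL i)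
  have h2 := sphereCard_pos hd hL i
  gcongr

theorem exists_isCritical (hd : 1 ≤ d) (hL : 2 ≤ L) (hA₁ : 0 < A₁)
    (h : IsProfile α A₁ A₂ ρ) {n : ℕ} (hn : 2 < L ^ (n * d)) : ∃ z, IsCritical L d ρ n z := by
  have hn' : (2 : ℝ) < (L : ℝ) ^ (n * d) := by exact_mod_cast hn
  have hmono := meanDegree_strictMono hd hL hA₁ h (one_le_of_two_lt_pow hn)
  have hcont : Continuous (meanDegree L d ρ n) := by
    unfold meanDegree; fun_prop
  have hlim : Tendsto (meanDegree L d ρ n) atTop (𝓝 ((L : ℝ) ^ (n * d) - 1)) := by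
    rw [← sum_sphereCard]
    refine tendsto_finsetSum _ fun i _ => ?_
    have h0 := h.pos hA₁ (one_le_pow_cast hL i)
    have : Tendsto (fun β : ℝ => Real.exp (-(β * ρ ((L : ℝ) ^ i)))) atTop (𝓝 0) :=
      Real.tendsto_exp_neg_atTop_nhds_zero.comp (tendsto_id.atTop_mul_const h0)
    simpa using (this.const_sub 1).const_mul (sphereCard L d i)
  obtain ⟨b, hb⟩ := (hlim.eventually (lt_mem_nhds (show (1 : ℝ) < _ by linarith))).exists
  have hzero : meanDegree L d ρ n 0 = 0 := by simp [meanDegree]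
  obtain ⟨β, hβ⟩ := mem_range_of_exists_le_of_exists_ge hcont ⟨0, by rw [hzero]; norm_num⟩
    ⟨b, hb.le⟩
  have hpos : 0 < β := by
    rw [← hmono.lt_iff_lt, hzero, hβ]; norm_num
  exact ⟨β⁻¹, isCritical_iff.2 ⟨inv_pos.2 hpos, by rw [inv_inv, hβ]⟩⟩

theorem isCritical_zeta (hd : 1 ≤ d) (hL : 2 ≤ L) (hA₁ : 0 < A₁)
    (h : IsProfile α A₁ A₂ ρ) {n : ℕ} (hn : 2 < L ^ (n * d)) :
    IsCritical L d ρ n (zeta L d ρ n) := by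
  have hex := exists_isCritical hd hL hA₁ h hn
  rw [zeta, dif_pos hex]
  exact hex.choose_spec

theorem IsCritical.eq (hd : 1 ≤ d) (hL : 2 ≤ L) (hA₁ : 0 < A₁)
    (h : IsProfile α A₁ A₂ ρ) {n : ℕ} (hn : 1 ≤ n) {z z' : ℝ} (hz : IsCritical L d ρ n z)
    (hz' : IsCritical L d ρ n z') : z = z' := by
  rw [isCritical_iff] at hz hz'
  exact inv_injective ((meanDegree_strictMono hd hL hA₁ h hn).injective (hz.2.trans hz'.2.symm))

theorem IsCritical.le (hd : 1 ≤ d) (hL : 2 ≤ L) (hα : α < d) (hA₂ : 0 < A₂)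
    (h : IsProfile α A₁ A₂ ρ) {n : ℕ} {z : ℝ} (hz : IsCritical L d ρ n z) :
    z ≤ A₂ * (growth L d α / (growth L d α - 1)) * growth L d α ^ n := by
  obtain ⟨hz0, hz1⟩ := isCritical_iff.1 hz
  have h1 := meanDegree_le (ρ := ρ) hd hL n z⁻¹
  rw [hz1] at h1
  have h2 := mul_le_mul_of_nonneg_left h1 hz0.le
  rw [mul_one, mul_inv_cancel_left₀ hz0.ne'] at h2
  exact h2.trans (sum_sphereCard_mul_le hL hα hA₂ h n)

/-- At criticality, already the neighbours at the maximal distance `L ^ n`, of which there is a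
positive proportion of all vertices, number at most one on average. -/
theorem IsCritical.ge (hd : 1 ≤ d) (hL : 2 ≤ L) (hA₁ : 0 < A₁)
    (h : IsProfile α A₁ A₂ ρ) {n : ℕ} (hn : 2 < L ^ (n * d)) {z : ℝ}
    (hz : IsCritical L d ρ n z) : A₁ / 6 * growth L d α ^ n ≤ z := by
  obtain ⟨hz0, hz1⟩ := isCritical_iff.1 hz
  have hn1 := one_le_of_two_lt_pow hn
  obtain ⟨m, rfl⟩ := Nat.exists_eq_add_of_le' hn1
  set N : ℝ := (L : ℝ) ^ ((m + 1) * d) with hN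
  have hN3 : 3 ≤ N := by rw [hN]; exact_mod_cast hn
  set W := sphereCard L d (m + 1) with hW
  have hWN : N / 2 ≤ W := by
    rw [hW, sphereCard_succ, ← hN]
    have h2 := two_le_pow hd hL
    have h3 : N = (L : ℝ) ^ d * (L : ℝ) ^ (m * d) := by rw [hN, ← pow_add]; ring_nf
    have h4 := one_le_pow_cast hL (m * d)
    nlinarith
  have hr := one_le_pow_cast hL (m + 1)
  set u := z⁻¹ * ρ ((L : ℝ) ^ (m + 1)) with hu
  have hu0 : 0 < u := mul_pos (inv_pos.2 hz0) (h.pos hA₁ hr)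
  have h1 : W * (1 - Real.exp (-u)) ≤ 1 := by
    refine le_trans ?_ hz1.le
    refine Finset.single_le_sum (f := fun i => sphereCard L d i *
      (1 - Real.exp (-(z⁻¹ * ρ ((L : ℝ) ^ i))))) (fun i _ => ?_)
      (Finset.mem_Icc.2 ⟨by omega, le_rfl⟩)
    have h0 := (h.pos hA₁ (one_le_pow_cast hL i)).le
    have h2 := (sphereCard_pos hd hL i).le
    have : Real.exp (-(z⁻¹ * ρ ((L : ℝ) ^ i))) ≤ 1 := Real.exp_le_one_iff.2 (by
      have := inv_pos.2 hz0
      have := mul_nonneg this.le h0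
      linarith)
    exact mul_nonneg h2 (by linarith)
  have h2 : (W - 1) * u ≤ 1 := by
    have h3 : W - 1 ≤ W * Real.exp (-u) := by linarith
    have h4 : (W - 1) * Real.exp u ≤ W := by
      calc (W - 1) * Real.exp u ≤ W * Real.exp (-u) * Real.exp u := by gcongr
        _ = W := by rw [mul_assoc, ← Real.exp_add]; simp
    have h5 := Real.add_one_le_exp u
    nlinarith
  -- From `N ≥ 3` and `W ≥ N / 2` it follows that `W - 1 ≥ N / 6`.
  have h3 : N * u ≤ 6 := by nlinarith
  have h4 : A₁ * growth L d α ^ (m + 1) ≤ N * ρ ((L : ℝ) ^ (m + 1)) := by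
    rw [← pow_mul_rpow_eq hL, ← hN]
    have := h.lower _ hr
    have hN0 : 0 ≤ N := by linarith
    calc _ = N * (A₁ * ((L : ℝ) ^ (m + 1)) ^ (-α)) := by ring
      _ ≤ _ := by gcongr
  have h5 : N * ρ ((L : ℝ) ^ (m + 1)) = z * (N * u) := by
    rw [hu]; field_simp
  nlinarith

end Degree

/-! ### Degrees in the graph at `(1 + t) * ζ⁻¹ * J` -/

section Regimes

variable {L d : ℕ} {α A₁ A₂ : ℝ} {ρ : ℝ → ℝ}

theorem two_lt_pow_mul (hd : 1 ≤ d) (hL : 2 ≤ L) {n : ℕ} (hn : 2 ≤ n) : 2 < L ^ (n * d) := by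
  calc 2 < 2 ^ 2 := by norm_num
    _ ≤ L ^ 2 := Nat.pow_le_pow_left hL 2
    _ ≤ L ^ (n * d) := Nat.pow_le_pow_right (by omega) (by nlinarith)

theorem inv_zeta_le (hd : 1 ≤ d) (hL : 2 ≤ L) (hα : α < d) (hA₁ : 0 < A₁)
    (h : IsProfile α A₁ A₂ ρ) {n : ℕ} (hn : 2 ≤ n) :
    (zeta L d ρ n)⁻¹ ≤ 6 / A₁ * (growth L d α ^ n)⁻¹ := by
  have hn' := two_lt_pow_mul hd hL hn
  have hr := one_lt_growth hL hα
  have := (isCritical_zeta hd hL hA₁ h hn').ge hd hL hA₁ h hn'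
  calc _ ≤ (A₁ / 6 * growth L d α ^ n)⁻¹ := inv_anti₀ (by positivity) this
    _ = _ := by rw [mul_inv, inv_div]

theorem zeta_pos (L d : ℕ) (ρ : ℝ → ℝ) (n : ℕ) : 0 < zeta L d ρ n := by
  rw [zeta]
  split_ifs with h
  · exact h.choose_spec.1
  · exact one_pos

theorem tendsto_inv_zeta (hd : 1 ≤ d) (hL : 2 ≤ L) (hα : α < d) (hA₁ : 0 < A₁)
    (h : IsProfile α A₁ A₂ ρ) : Tendsto (fun n => (zeta L d ρ n)⁻¹) atTop (𝓝 0) := by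
  have hr := one_lt_growth hL hα
  have hlim : Tendsto (fun n => 6 / A₁ * (growth L d α ^ n)⁻¹) atTop (𝓝 0) := by
    simpa using (tendsto_inv_atTop_zero.comp (tendsto_pow_atTop_atTop_of_one_lt hr)).const_mul
      (6 / A₁)
  refine tendsto_of_tendsto_of_tendsto_of_le_of_le' tendsto_const_nhds hlim
    (Eventually.of_forall fun n => (inv_pos.2 (zeta_pos L d ρ n)).le) ?_
  filter_upwards [eventually_ge_atTop 2] with n hn
  exact inv_zeta_le hd hL hα hA₁ h hn

theorem kernelR_nonneg (h : IsProfile α A₁ A₂ ρ) (n : ℕ) {t : ℝ}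
    (ht : 0 ≤ 1 + t) (x y : Lattice L d) : 0 ≤ kernelR ρ n t x y :=
  mul_nonneg (mul_nonneg ht (inv_pos.2 (zeta_pos L d ρ n)).le) (h.nonneg _ (Nat.cast_nonneg _))

theorem sum_kernelR_eq_meanDegree [NeZero L] (hL : 2 ≤ L) (h : IsProfile α A₁ A₂ ρ) (n : ℕ)
    (t : ℝ) {x : Lattice L d} (hx : x ∈ boxFinset L d n) :
    ∑ y ∈ boxFinset L d n, (1 - Real.exp (-kernelR ρ n t x y)) =
      meanDegree L d ρ n ((1 + t) * (zeta L d ρ n)⁻¹) := by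
  have := sum_boxFinset_sub hL
    (fun k => 1 - Real.exp (-((1 + t) * (zeta L d ρ n)⁻¹ * ρ (k : ℝ)))) hx
  simp only [Nat.cast_zero, h.zero, mul_zero, neg_zero, Real.exp_zero, sub_self, zero_add,
    Nat.cast_pow] at this
  exact this

/-- Since single edges have vanishing probability, the mean degree is asymptotically linear in the
kernel. -/
theorem eventually_meanDegree_le (hd : 1 ≤ d) (hL : 2 ≤ L) (hα : 0 < α) (hα' : α < d)
    (hA₁ : 0 < A₁) (hA₂ : 0 < A₂) (h : IsProfile α A₁ A₂ ρ) {ε : ℝ} (hε : 0 < ε) (hε1 : ε < 1) :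
    ∀ᶠ n in atTop, meanDegree L d ρ n ((1 + -ε) * (zeta L d ρ n)⁻¹) ≤ 1 - ε / 2 := by
  have hlim := (tendsto_inv_zeta hd hL hα' hA₁ h).mul_const A₂
  rw [zero_mul] at hlim
  filter_upwards [eventually_ge_atTop 2,
    hlim.eventually (gt_mem_nhds (show (0 : ℝ) < ε / 2 by linarith))] with n hn hη
  have hβ := inv_pos.2 (zeta_pos L d ρ n)
  have hone := (isCritical_iff.1 (isCritical_zeta hd hL hA₁ h (two_lt_pow_mul hd hL hn))).2
  have h1 := le_meanDegree hd hL hα hA₁ hA₂ h n hβ.le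
  rw [hone] at h1
  set T := (zeta L d ρ n)⁻¹ * ∑ i ∈ Finset.Icc 1 n, sphereCard L d i * ρ ((L : ℝ) ^ i) with hT
  have h2 := meanDegree_le (ρ := ρ) hd hL n (zeta L d ρ n)⁻¹
  rw [hone, ← hT] at h2
  refine (meanDegree_le hd hL n _).trans ?_
  rw [mul_assoc, ← hT]
  have h3 : (1 - ε / 2) * T ≤ 1 := by nlinarith
  nlinarith

theorem eventually_le_meanDegree (hd : 1 ≤ d) (hL : 2 ≤ L) (hα : 0 < α) (hα' : α < d)
    (hA₁ : 0 < A₁) (hA₂ : 0 < A₂) (h : IsProfile α A₁ A₂ ρ) {ε : ℝ} (hε : 0 < ε) :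
    ∀ᶠ n in atTop, 1 + ε / 2 ≤ meanDegree L d ρ n ((1 + ε) * (zeta L d ρ n)⁻¹) := by
  have hlim : Tendsto (fun n => (1 + ε) * (1 - (1 + ε) * (zeta L d ρ n)⁻¹ * A₂)) atTop
      (𝓝 (1 + ε)) := by
    simpa using ((((tendsto_inv_zeta hd hL hα' hA₁ h).const_mul (1 + ε)).mul_const A₂).const_sub
      1).const_mul (1 + ε)
  filter_upwards [eventually_ge_atTop 2,
    hlim.eventually (lt_mem_nhds (show 1 + ε / 2 < 1 + ε by linarith))] with n hn hη
  have hβ := inv_pos.2 (zeta_pos L d ρ n)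
  have hone := (isCritical_iff.1 (isCritical_zeta hd hL hA₁ h (two_lt_pow_mul hd hL hn))).2
  have h2 := meanDegree_le (ρ := ρ) hd hL n (zeta L d ρ n)⁻¹
  have h1 := le_meanDegree hd hL hα hA₁ hA₂ h n (mul_pos (by linarith : 0 < 1 + ε) hβ).le
  rw [hone] at h2
  refine le_trans ?_ h1
  set η := (1 + ε) * (zeta L d ρ n)⁻¹ * A₂
  have hη1 : 0 < 1 - η := by
    by_contra hcon
    nlinarith
  calc 1 + ε / 2 ≤ (1 - η) * ((1 + ε) * 1) := by linarith
    _ ≤ (1 - η) * ((1 + ε) * ((zeta L d ρ n)⁻¹ *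
        ∑ i ∈ Finset.Icc 1 n, sphereCard L d i * ρ ((L : ℝ) ^ i))) := by gcongr
    _ = _ := by ring

/-- The mean number of neighbours in a set `D`, split into those within distance `L ^ m` and those
beyond. -/
theorem sum_one_sub_exp_le [NeZero L] (hL : 2 ≤ L) (hα : 0 < α) (hα' : α < d) (hA₂ : 0 < A₂)
    (h : IsProfile α A₁ A₂ ρ) (x : Lattice L d) (D : Finset (Lattice L d)) (m : ℕ) {b : ℝ}
    (hb : 0 ≤ b) :
    ∑ y ∈ D, (1 - Real.exp (-(b * ρ (hnorm (x - y))))) ≤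
      b * (A₂ * (growth L d α / (growth L d α - 1)) * growth L d α ^ m +
        D.card * (A₂ * ((L : ℝ) ^ m) ^ (-α))) := by
  classical
  have hnn : ∀ w : Lattice L d, 0 ≤ ρ (hnorm w) := fun w => h.nonneg _ (Nat.cast_nonneg _)
  have hinj : Function.Injective fun y : Lattice L d => x - y := sub_right_injective
  calc ∑ y ∈ D, (1 - Real.exp (-(b * ρ (hnorm (x - y)))))
      ≤ ∑ y ∈ D, b * ρ (hnorm (x - y)) := Finset.sum_le_sum fun y _ => by
        have := Real.add_one_le_exp (-(b * ρ (hnorm (x - y))))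
        linarith
    _ = b * (∑ y ∈ D with x - y ∈ boxFinset L d m, ρ (hnorm (x - y)) +
          ∑ y ∈ D with x - y ∉ boxFinset L d m, ρ (hnorm (x - y))) := by
        rw [Finset.sum_filter_add_sum_filter_not, Finset.mul_sum]
    _ ≤ _ := by
        gcongr
        · rw [← Finset.sum_image (f := fun w => ρ (hnorm w)) (g := fun y => x - y)
            (fun _ _ _ _ hxy => hinj hxy)]
          calc _ ≤ ∑ w ∈ boxFinset L d m, ρ (hnorm w) := by
                refine Finset.sum_le_sum_of_subset_of_nonneg ?_ fun w _ _ => hnn w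
                intro w hw
                obtain ⟨y, hy, rfl⟩ := Finset.mem_image.1 hw
                exact (Finset.mem_filter.1 hy).2
            _ = ∑ i ∈ Finset.Icc 1 m, sphereCard L d i * ρ ((L : ℝ) ^ i) := by
                rw [sum_boxFinset hL (fun k => ρ (k : ℝ)) m]
                simp [h.zero]
            _ ≤ _ := sum_sphereCard_mul_le hL hα' hA₂ h m
        · calc _ ≤ ∑ y ∈ D with x - y ∉ boxFinset L d m, A₂ * ((L : ℝ) ^ m) ^ (-α) := by
                refine Finset.sum_le_sum fun y hy => ?_
                have hy' := (Finset.mem_filter.1 hy).2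
                rw [← hnorm_le_pow_iff hL, not_le] at hy'
                have hle : (L : ℝ) ^ m ≤ hnorm (x - y) := by exact_mod_cast hy'.le
                have h1 := one_le_pow_cast hL m
                refine (h.upper _ (h1.trans hle)).trans ?_
                exact mul_le_mul_of_nonneg_left
                  (Real.rpow_le_rpow_of_nonpos (by linarith) hle (by linarith)) hA₂.le
            _ ≤ ∑ y ∈ D, A₂ * ((L : ℝ) ^ m) ^ (-α) :=
                Finset.sum_le_sum_of_subset_of_nonneg (Finset.filter_subset _ _)
                  fun _ _ _ => by positivity
            _ = _ := by rw [Finset.sum_const, nsmul_eq_mul]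

/-- A small positive proportion of the vertices carries little of the mean degree of any vertex,
uniformly in the profile: vertices within distance `L ^ (n - k)` contribute little for large `k`,
and each other vertex contributes at most a constant times `L ^ (-n d)`. -/
theorem exists_proportion (hd : 1 ≤ d) (hL : 2 ≤ L) (hα : 0 < α) (hα' : α < d) (hA₁ : 0 < A₁)
    (hA₂ : 0 < A₂) [NeZero L] {ε : ℝ} (hε : 0 < ε) :
    ∃ θ : ℝ, 0 < θ ∧ θ ≤ 1 ∧ ∃ n₀ : ℕ, ∀ ρ : ℝ → ℝ, IsProfile α A₁ A₂ ρ → ∀ n ≥ n₀,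
      ∀ x : Lattice L d, ∀ D : Finset (Lattice L d), (D.card : ℝ) ≤ θ * (L : ℝ) ^ (n * d) →
        ∑ y ∈ D, (1 - Real.exp (-kernelR ρ n ε x y)) ≤ ε / 4 := by
  set r := growth L d α with hr_def
  have hr : 1 < r := one_lt_growth hL hα'
  have hr0 : 0 < r - 1 := by linarith
  set a := (1 + ε) * (6 / A₁) * A₂ with ha_def
  have ha : 0 < a := by positivity
  -- Distances up to `L ^ (n - k)` contribute at most `a * r / (r - 1) * r ^ (-k)`.
  obtain ⟨k, hk⟩ := exists_pow_lt_of_lt_one (show 0 < ε / (8 * (a * (r / (r - 1)))) by positivity)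
    (inv_lt_one_of_one_lt₀ hr)
  have hLpos : (0 : ℝ) < L := by exact_mod_cast (by omega : 0 < L)
  set q := ((L : ℝ) ^ k) ^ (-α) with hq_def
  have hq : 0 < q := by positivity
  refine ⟨min 1 (ε * q / (8 * a)), by positivity, min_le_left _ _, k + 2,
    fun ρ h n hn x D hD => ?_⟩
  obtain ⟨m, rfl⟩ := Nat.exists_eq_add_of_le' (show k ≤ n by omega)
  have hβ := inv_pos.2 (zeta_pos L d ρ (m + k))
  have hβle := inv_zeta_le hd hL hα' hA₁ h (n := m + k) (by omega)
  rw [← hr_def] at hβle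
  have hcard : (D.card : ℝ) ≤ ε * q / (8 * a) * (L : ℝ) ^ ((m + k) * d) :=
    hD.trans (mul_le_mul_of_nonneg_right (min_le_right _ _) (by positivity))
  have hsum := sum_one_sub_exp_le hL hα hα' hA₂ h x D m
    (mul_pos (by linarith : 0 < 1 + ε) hβ).le
  have hrpow : r ^ (m + k) = (L : ℝ) ^ ((m + k) * d) * (((L : ℝ) ^ m) ^ (-α) * q) := by
    rw [hr_def, ← pow_mul_rpow_eq hL, pow_add (L : ℝ) m k,
      Real.mul_rpow (by positivity) (by positivity)]
  have hnear : r ^ m = r⁻¹ ^ k * r ^ (m + k) := by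
    rw [pow_add, inv_pow]; field_simp
  set R := r ^ (m + k) with hR
  have hR0 : 0 < R := by positivity
  have hfar : D.card * ((L : ℝ) ^ m) ^ (-α) ≤ ε / (8 * a) * R := by
    calc _ ≤ ε * q / (8 * a) * (L : ℝ) ^ ((m + k) * d) * ((L : ℝ) ^ m) ^ (-α) := by gcongr
      _ = _ := by rw [hrpow]; ring
  have hnear' : r / (r - 1) * r ^ m ≤ ε / (8 * a) * R := by
    rw [hnear]
    calc _ = r / (r - 1) * r⁻¹ ^ k * R := by ring
      _ ≤ r / (r - 1) * (ε / (8 * (a * (r / (r - 1))))) * R := by gcongr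
      _ = _ := by field_simp
  refine hsum.trans ?_
  rw [← hr_def]
  calc _ = (1 + ε) * (zeta L d ρ (m + k))⁻¹ * A₂ *
        (r / (r - 1) * r ^ m + D.card * ((L : ℝ) ^ m) ^ (-α)) := by ring
    _ ≤ (1 + ε) * (6 / A₁ * R⁻¹) * A₂ * (ε / (8 * a) * R + ε / (8 * a) * R) := by gcongr
    _ = a * (ε / (8 * a) + ε / (8 * a)) := by rw [ha_def]; field_simp
    _ = ε / 4 := by field_simp; ring

end Regimes

/-! ### The two regimes -/

section Limit

/-- Probabilities tend to `1` if those of sets covering the complements tend to `0`; no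
measurability is needed. -/
theorem tendsto_measure_one {Ω : Type*} [MeasurableSpace Ω] {μ : ℕ → Measure Ω}
    [∀ n, IsProbabilityMeasure (μ n)] {s t : ℕ → Set Ω} {b : ℕ → ℝ} (hst : ∀ n, (s n)ᶜ ⊆ t n)
    (hb : Tendsto b atTop (𝓝 0)) (h : ∀ᶠ n in atTop, μ n (t n) ≤ ENNReal.ofReal (b n)) :
    Tendsto (fun n => μ n (s n)) atTop (𝓝 1) := by
  have hlim : Tendsto (fun n => 1 - ENNReal.ofReal (b n)) atTop (𝓝 1) := by
    have h1 : Tendsto (fun n => ENNReal.ofReal (b n)) atTop (𝓝 0) := by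
      simpa using ENNReal.tendsto_ofReal hb
    simpa using ENNReal.Tendsto.sub tendsto_const_nhds h1 (Or.inl ENNReal.one_ne_top)
  refine tendsto_of_tendsto_of_tendsto_of_le_of_le' hlim tendsto_const_nhds ?_
    (Eventually.of_forall fun n => prob_le_one)
  filter_upwards [h] with n hn
  rw [tsub_le_iff_right]
  calc (1 : ENNReal) = μ n (s n ∪ (s n)ᶜ) := by rw [Set.union_compl_self, measure_univ]
    _ ≤ μ n (s n) + μ n (s n)ᶜ := measure_union_le _ _
    _ ≤ _ := by gcongr; exact (measure_mono (hst n)).trans hn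

theorem isProbabilityMeasure_edgeLaw {V : Type*} {κ : V → V → ℝ} (hκ : ∀ x y, κ x y = κ y x) :
    IsProbabilityMeasure (edgeLaw κ hκ) := by
  unfold edgeLaw; infer_instance

variable {L d : ℕ} {α A₁ A₂ : ℝ}

theorem maxComponent_eq [NeZero L] (hL : 2 ≤ L) (n : ℕ) (ω : Sym2 (Lattice L d) → Bool) :
    maxComponent n ω =
      largestComponentCard ((graphOf ω).induce (boxFinset L d n : Set (Lattice L d))) := by
  rw [maxComponent, box_eq_coe_boxFinset hL]

/-- Below criticality every mean degree is at most `1 - ε / 2` for large `n`, so that the union bound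
over the `L ^ (n d)` vertices leaves a probability of at most `2 exp (-n)`. -/
theorem tendsto_subcritical (hd : 1 ≤ d) (hL : 2 ≤ L) (hα : 0 < α) (hα' : α < d) (hA₁ : 0 < A₁)
    (hA₂ : 0 < A₂) {ρ : ℝ → ℝ} (h : IsProfile α A₁ A₂ ρ) {ε : ℝ} (hε : 0 < ε) (hε1 : ε < 1) :
    Tendsto (fun n : ℕ => lawR L d ρ n (-ε)
      {ω | (maxComponent n ω : ℝ) ≤ 8 * (d * Real.log L + 1) * n * (ε ^ 2)⁻¹}) atTop (𝓝 1) := by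
  have : NeZero L := ⟨by omega⟩
  have hLpos : (0 : ℝ) < L := by exact_mod_cast (by omega : 0 < L)
  have hlog : 0 ≤ Real.log L := Real.log_natCast_nonneg L
  have hprob : ∀ n, IsProbabilityMeasure (lawR L d ρ n (-ε)) := fun n =>
    isProbabilityMeasure_edgeLaw _
  refine tendsto_measure_one (t := fun n => {ω | 8 * (d * Real.log L + 1) * n * (ε ^ 2)⁻¹ <
    (maxComponent n ω : ℝ)}) (b := fun n : ℕ => 2 * Real.exp (-(n : ℝ))) (fun n ω hω => ?_) ?_ ?_
  · simpa only [Set.mem_compl_iff, Set.mem_ofPred_eq, not_le] using hω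
  · simpa using (Real.tendsto_exp_neg_atTop_nhds_zero.comp tendsto_natCast_atTop_atTop).const_mul
      (2 : ℝ)
  · filter_upwards [eventually_meanDegree_le hd hL hα hα' hA₁ hA₂ h hε hε1] with n hn
    simp only [maxComponent_eq hL]
    refine (measure_lt_largestComponentCard_le (kernelR_symm ρ n (-ε))
      (kernelR_nonneg h n (by linarith)) (S := boxFinset L d n) (δ := ε / 2) (by linarith)
      (by linarith) (fun x hx => by rw [sum_kernelR_eq_meanDegree hL h n _ hx]; exact hn)
      (by positivity)).trans (ENNReal.ofReal_le_ofReal (le_of_eq ?_))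
    rw [card_boxFinset, Nat.cast_pow]
    have h1 : (L : ℝ) ^ (n * d) = Real.exp (n * d * Real.log L) := by
      rw [← Real.rpow_natCast, Real.rpow_def_of_pos hLpos]
      push_cast
      ring_nf
    rw [h1, mul_left_comm, ← Real.exp_add]
    congr 2
    field_simp
    ring

theorem tendsto_add_one_mul_exp_neg {c : ℝ} (hc : 0 < c) :
    Tendsto (fun N : ℝ => (N + 1) * Real.exp (-(c * N))) atTop (𝓝 0) := by
  have h1 := (Real.tendsto_pow_mul_exp_neg_atTop_nhds_zero 1).comp
    (tendsto_id.const_mul_atTop hc)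
  have h2 := Real.tendsto_exp_neg_atTop_nhds_zero.comp (tendsto_id.const_mul_atTop hc)
  have h3 := (h1.const_mul c⁻¹).add h2
  simp only [mul_zero, add_zero] at h3
  refine h3.congr fun N => ?_
  simp only [Function.comp, id, pow_one]
  field_simp

/-- Above criticality the mean degrees are at least `1 + ε / 2` for large `n`, and removing a small
proportion of the vertices lowers them by at most `ε / 4`. -/
theorem tendsto_supercritical (hd : 1 ≤ d) (hL : 2 ≤ L) (hα : 0 < α) (hα' : α < d)
    (hA₁ : 0 < A₁) (hA₂ : 0 < A₂) {ε : ℝ} (hε : 0 < ε) :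
    ∃ C : ℝ, 0 < C ∧ ∀ ρ : ℝ → ℝ, IsProfile α A₁ A₂ ρ →
      Tendsto (fun n : ℕ => lawR L d ρ n ε
        {ω | C * (L : ℝ) ^ (n * d) ≤ (maxComponent n ω : ℝ)}) atTop (𝓝 1) := by
  have : NeZero L := ⟨by omega⟩
  obtain ⟨θ, hθ, hθ1, n₀, hθD⟩ := exists_proportion (d := d) hd hL hα hα' hA₁ hA₂ hε
  refine ⟨θ / 2, by positivity, fun ρ h => ?_⟩
  have hprob : ∀ n, IsProbabilityMeasure (lawR L d ρ n ε) := fun n =>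
    isProbabilityMeasure_edgeLaw _
  set δ := min (ε / 4) 1 with hδ_def
  have hδ : 0 < δ := by positivity
  have hN : Tendsto (fun n : ℕ => (L : ℝ) ^ (n * d)) atTop atTop := by
    have h1 : 1 < (L : ℝ) ^ d := by linarith [two_le_pow hd hL]
    refine (tendsto_pow_atTop_atTop_of_one_lt h1).congr fun n => ?_
    rw [← pow_mul, mul_comm]
  refine tendsto_measure_one
    (t := fun n => {ω | (maxComponent n ω : ℝ) < θ / 2 * (L : ℝ) ^ (n * d)})
    (b := fun n : ℕ => ((L : ℝ) ^ (n * d) + 1) *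
      Real.exp (-(δ ^ 2 / 8 * (θ / 2) * (L : ℝ) ^ (n * d)))) (fun n ω hω => ?_) ?_ ?_
  · simpa only [Set.mem_compl_iff, Set.mem_ofPred_eq, not_le] using hω
  · exact (tendsto_add_one_mul_exp_neg (by positivity)).comp hN
  · filter_upwards [eventually_le_meanDegree hd hL hα hα' hA₁ hA₂ h hε,
      eventually_ge_atTop n₀] with n hn hn₀
    have hcard : ((boxFinset L d n).card : ℝ) = (L : ℝ) ^ (n * d) := by
      rw [card_boxFinset, Nat.cast_pow]
    simp only [maxComponent_eq hL]
    have key := measure_largestComponentCard_lt_le (kernelR_symm ρ n ε)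
      (kernelR_nonneg h n (by linarith)) (S := boxFinset L d n) hδ (min_le_right _ _)
      hθ hθ1 (by rw [card_boxFinset]; positivity) (fun x hx D hD hDc => ?_)
    · rw [hcard, ← mul_assoc] at key
      exact key
    · rw [hcard] at hDc
      have h1 := Finset.sum_sdiff hD (f := fun y => 1 - Real.exp (-kernelR ρ n ε x y))
      rw [sum_kernelR_eq_meanDegree hL h n _ hx] at h1
      have h2 := hθD ρ h n hn₀ x D hDc
      have h3 : δ ≤ ε / 4 := min_le_left _ _
      have h4 : 1 + δ ≤ ∑ y ∈ boxFinset L d n \ D, (1 - Real.exp (-kernelR ρ n ε x y)) := by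
        linarith
      -- The two sides differ in the decidability instance behind the set difference.
      convert h4

end Limit

end HLPercolation

open HLPercolation
theorem proposition2p1 (d L : ℕ) (hd : 1 ≤ d) (hL : 2 ≤ L) :
    -- existence, uniqueness and order of magnitude of `ζ_n`
    (∀ α A₁ A₂ : ℝ, 0 < α → α < d → 0 < A₁ → A₁ ≤ A₂ →
      ∃ C C' : ℝ, 0 < C ∧ 0 < C' ∧ ∀ ρ : ℝ → ℝ, IsProfile α A₁ A₂ ρ →
        ∀ n : ℕ, 2 < L ^ (n * d) →
          IsCritical L d ρ n (zeta L d ρ n) ∧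
          (∀ z : ℝ, IsCritical L d ρ n z → z = zeta L d ρ n) ∧
          C * (L : ℝ) ^ ((n : ℝ) * ((d : ℝ) - α)) ≤ zeta L d ρ n ∧
          zeta L d ρ n ≤ C' * (L : ℝ) ^ ((n : ℝ) * ((d : ℝ) - α))) ∧
    -- subcritical regime: the constant depends only on `d` and `L`
    (∃ C : ℝ, 0 < C ∧ ∀ α A₁ A₂ : ℝ, 0 < α → α < d → 0 < A₁ → A₁ ≤ A₂ →
      ∀ ρ : ℝ → ℝ, IsProfile α A₁ A₂ ρ → ∀ ε : ℝ, 0 < ε → ε < 1 →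
        Tendsto
          (fun n : ℕ => lawR L d ρ n (-ε) {ω | (maxComponent n ω : ℝ) ≤ C * n * (ε ^ 2)⁻¹})
          atTop (𝓝 1)) ∧
    -- supercritical regime: the constant depends only on `ε`, `α`, `A₁`, `A₂`, `d` and `L`
    (∀ α A₁ A₂ : ℝ, 0 < α → α < d → 0 < A₁ → A₁ ≤ A₂ → ∀ ε : ℝ, 0 < ε →
      ∃ C : ℝ, 0 < C ∧ ∀ ρ : ℝ → ℝ, IsProfile α A₁ A₂ ρ →
        Tendsto
          (fun n : ℕ => lawR L d ρ n ε {ω | C * (L : ℝ) ^ (n * d) ≤ (maxComponent n ω : ℝ)})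
          atTop (𝓝 1)) := by
  refine ⟨fun α A₁ A₂ hα hα' hA₁ hA => ?_, ?_, fun α A₁ A₂ hα hα' hA₁ hA ε hε =>
    tendsto_supercritical hd hL hα hα' hA₁ (hA₁.trans_le hA) hε⟩
  · have hA₂ := hA₁.trans_le hA
    have hr := one_lt_growth hL hα'
    have hr0 : 0 < growth L d α - 1 := by linarith
    refine ⟨A₁ / 6, A₂ * (growth L d α / (growth L d α - 1)), by positivity, by positivity,
      fun ρ h n hn => ?_⟩
    have hz := isCritical_zeta hd hL hA₁ h hn
    rw [← growth_pow]
    exact ⟨hz, fun z hz' => hz'.eq hd hL hA₁ h (one_le_of_two_lt_pow hn) hz,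
      hz.ge hd hL hA₁ h hn, hz.le hd hL hα' hA₂ h⟩
  · have hlog : 0 ≤ Real.log L := Real.log_natCast_nonneg L
    exact ⟨8 * (d * Real.log L + 1), by positivity, fun α A₁ A₂ hα hα' hA₁ hA ρ h ε hε hε1 =>
      tendsto_subcritical hd hL hα hα' hA₁ (hA₁.trans_le hA) h hε hε1⟩
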